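/- **Conventions.** Algorithms are deterministic word-RAM programs: unit-cost arithmetic and bitwise operations, indirect addressing, and words of $O(\log N)$ bits on inputs of length $N$. "Combinatorial algorithm" is an informal notion ("avoiding fast matrix multiplication"). The statement is claimed for every class $\mathcal C$ of such programs, called the *combinatorial* ones, that is closed under linear-time preprocessing: if $p\in\mathcal C$ and $r$ transforms inputs into inputs in linear time, then the program that first runs $r$ and then $p$ is in $\mathcal C$. *Strong Triangle Conjecture (STC) for $\mathcal C$*: for no $\varepsilon>0$ does $\mathcal C$ contain an $O(n^{3-\varepsilon})$-time algorithm that decides, for a (directed) graph $(V,E)$ on $n$ vertices given by its adjacency matrix, whether there are $x,y,z\in V$ with $(x,y),(y,z),(z,x)\in E$. An *MDP* $P$ is a finite directed graph $(V,E)$ with $n\ge 1$ vertices, in which every vertex has a successor, together with a partition of $V$ into player 1 vertices $V_1$ and random vertices $V_R$. At a random vertex the next vertex is uniformly distributed on its successors. At a player 1 vertex it is a successor chosen by a strategy $\sigma$ on the basis of the history. *Graphs* are MDPs with $V_R=\emptyset$. An objective $\psi$ is a set of infinite paths, and its *almost-sure (a.s.) winning set* is $\{v : \Pr^\sigma_v(\psi)=1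 \text{ for some strategy } \sigma\}$; on graphs it is called the winning set. Let $\mathrm{Inf}(\omega)$ be the set of vertices that occur infinitely often on the path $\omega$. For $T, L_i,U_i\subseteq V$ let $$\text{Büchi}(T)=\{\omega:\mathrm{Inf}(\omega)\cap T\neq\emptyset\},\qquad \text{coBüchi}(T)=\{\omega:\mathrm{Inf}(\omega)\cap T=\emptyset\},$$ $$\text{Rabin}((L_i,U_i)_{i\le k})=\{\omega:\exists i\le k,\ \mathrm{Inf}(\omega)\cap L_i\ne\emptyset \text{ and } \mathrm{Inf}(\omega)\cap U_i=\emptyset\}.$$ For objectives $\psi_1,\dots,\psi_k$, the winning set of the *disjunctive objective* is the a.s. winning set of $\bigcup_i\psi_i$, and the winning set of the *disjunctive query* is the union of the a.s. winning sets of the $\psi_i$. Instances are given by $n$, $k$, the adjacency matrix, and the characteristic vectors of $V_R$ and of the $k$ target sets (resp. $k$ Rabin pairs). **Theorem.** Assume STC for $\mathcal C$. Then for no $\varepsilon>0$ does $\mathcal C$ contain an algorithm with running time $O(n^{3-\varepsilon})$ or $O((k\cdot n^2)^{1-\varepsilon})$ for any of the following problems, not even for instances with $k=\Theta(n)$ (that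 is, instances with $n\le a k$ and $k\le a n$, for a suitable constant $a$): 1. computing the a.s. winning set in an MDP with a disjunctive query of $k$ Büchi objectives; 2. computing the winning set in a graph with a disjunctive objective of $k$ coBüchi objectives; and thus also computing the a.s. winning set in an MDP with a disjunctive coBüchi objective, or with a disjunctive coBüchi query; 3. computing the a.s. winning set in an MDP with a Rabin objective of $k$ pairs. -/

import Mathlib

/-! ## Word RAM programs with a step count -/

/-- The arithmetic and bitwise operations of the machine (subtraction is truncated, division by
zero gives zero). -/
inductive BinOp
  | add | sub | mul | div | mod | land | lor | lxor | shl | shr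

/-- The value of an operation. -/
def BinOp.eval : BinOp → ℕ → ℕ → ℕ
  | .add, a, b => a + b
  | .sub, a, b => a - b
  | .mul, a, b => a * b
  | .div, a, b => a / b
  | .mod, a, b => a % b
  | .land, a, b => a &&& b
  | .lor, a, b => a ||| b
  | .lxor, a, b => a ^^^ b
  | .shl, a, b => a <<< b
  | .shr, a, b => a >>> b

/-- Structured programs of the word RAM. The arguments are indices of registers, except for the
second argument of `const`, which is a literal constant. -/
inductive Prog
  /-- do nothing -/
  | skip
  /-- `reg d := c` -/
  | const (d c : ℕ)
  /-- `reg d := o (reg a) (reg b)` -/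
  | op (o : BinOp) (d a b : ℕ)
  /-- `reg d := mem (reg a)` -/
  | load (d a : ℕ)
  /-- `mem (reg a) := reg b` -/
  | store (a b : ℕ)
  /-- first `p`, then `q` -/
  | seq (p q : Prog)
  /-- if `reg a < reg b` then `p` else `q` -/
  | ite (a b : ℕ) (p q : Prog)
  /-- while `reg a < reg b` do `p` -/
  | loop (a b : ℕ) (p : Prog)

/-- A state of the machine: registers and a memory of cells. -/
@[ext] structure RamState where
  reg : ℕ → ℕ
  mem : ℕ → ℕ

/-- Write `x` into register `d`. -/
def RamState.setReg (s : RamState) (d x : ℕ) : RamState :=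
  ⟨Function.update s.reg d x, s.mem⟩

/-- Write `x` into memory cell `i`. -/
def RamState.setMem (s : RamState) (i x : ℕ) : RamState :=
  ⟨s.reg, Function.update s.mem i x⟩

/-- The initial state on input `x`: cell `i` holds the `i`-th entry of `x` (and zero beyond the end
of `x`), register `0` holds the length of `x`, and the other registers hold zero. -/
def RamState.init (x : List ℕ) : RamState :=
  ⟨fun r => if r = 0 then x.length else 0, fun i => x.getD i 0⟩

/-- `Exec B p s t s'`: started in state `s`, the program `p` halts after exactly `t` unit-cost steps
in state `s'`, and no value `≥ B` is ever written (that is, the computation fits into words which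
hold the numbers below `B`). -/
inductive Exec (B : ℕ) : Prog → RamState → ℕ → RamState → Prop
  | skip (s : RamState) : Exec B .skip s 1 s
  | const (s : RamState) (d c : ℕ) (h : c < B) : Exec B (.const d c) s 1 (s.setReg d c)
  | op (s : RamState) (o : BinOp) (d a b : ℕ) (h : o.eval (s.reg a) (s.reg b) < B) :
      Exec B (.op o d a b) s 1 (s.setReg d (o.eval (s.reg a) (s.reg b)))
  | load (s : RamState) (d a : ℕ) (h : s.mem (s.reg a) < B) :
      Exec B (.load d a) s 1 (s.setReg d (s.mem (s.reg a)))
  | store (s : RamState) (a b : ℕ) (h : s.reg b < B) :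
      Exec B (.store a b) s 1 (s.setMem (s.reg a) (s.reg b))
  | seq {p q : Prog} {s s' s'' : RamState} {t t' : ℕ} (hp : Exec B p s t s')
      (hq : Exec B q s' t' s'') : Exec B (.seq p q) s (t + t') s''
  | ite_lt {a b : ℕ} {p q : Prog} {s s' : RamState} {t : ℕ} (h : s.reg a < s.reg b)
      (hp : Exec B p s t s') : Exec B (.ite a b p q) s (t + 1) s'
  | ite_ge {a b : ℕ} {p q : Prog} {s s' : RamState} {t : ℕ} (h : ¬ s.reg a < s.reg b)
      (hq : Exec B q s t s') : Exec B (.ite a b p q) s (t + 1) s'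
  | loop_ge {a b : ℕ} {p : Prog} {s : RamState} (h : ¬ s.reg a < s.reg b) :
      Exec B (.loop a b p) s 1 s
  | loop_lt {a b : ℕ} {p : Prog} {s s' s'' : RamState} {t t' : ℕ} (h : s.reg a < s.reg b)
      (hp : Exec B p s t s') (hl : Exec B (.loop a b p) s' t' s'') :
      Exec B (.loop a b p) s (t + t' + 1) s''

/-- The output `y` of a computation is read from the first cells of the memory. -/
def RamState.Outputs (s : RamState) (y : List ℕ) : Prop :=
  ∀ i, (h : i < y.length) → s.mem i = y[i]

/-! ## Algorithmic problems and running times -/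

/-- An algorithmic problem: its instances, the parameters `n` and `k` of an instance, the encoding
of an instance as an input, and the answer that has to be computed. -/
structure Problem where
  Inst : Type
  n : Inst → ℕ
  k : Inst → ℕ
  encode : Inst → List ℕ
  answer : Inst → List ℕ

/-- The program `p` computes, with words of `O(log N)` bits for inputs of length `N`, the right
answer in time `O(τ)` on all instances of the problem that lie in `S`. -/
def SolvesInTime (p : Prog) (Q : Problem) (S : Set Q.Inst) (τ : Q.Inst → ℝ) : Prop :=
  ∃ (K : ℝ) (c : ℕ), ∀ I ∈ S, ∃ (t : ℕ) (s : RamState),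
    Exec (((Q.encode I).length + 2) ^ c) p (RamState.init (Q.encode I)) t s ∧
      s.Outputs (Q.answer I) ∧ (t : ℝ) ≤ K * τ I

/-- The program `r` transforms every input `x` (a list whose entries do not exceed its length) into
some other input `y`, in time linear in the length of `x`. -/
def LinearTimeTransformation (r : Prog) : Prop :=
  ∃ K c : ℕ, ∀ x : List ℕ, (∀ e ∈ x, e ≤ x.length) → ∃ (y : List ℕ) (t : ℕ),
    Exec ((x.length + 2) ^ c) r (RamState.init x) t (RamState.init y) ∧ t ≤ K * (x.length + 1)

/-- A class of algorithms is closed under linear-time preprocessing if transforming the input in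
linear time and then running an algorithm of the class is again an algorithm of the class. -/
def ClosedUnderLinearTimePreprocessing (C : Set Prog) : Prop :=
  ∀ r p : Prog, LinearTimeTransformation r → p ∈ C → Prog.seq r p ∈ C

/-- The entry of an encoding that tells whether a statement holds. -/
noncomputable def bit (p : Prop) : ℕ := by
  classical exact if p then 1 else 0

/-! ## Triangle detection -/

/-- The adjacency matrix of a relation on `Fin n`, row by row. -/
noncomputable def encodeEdges {n : ℕ} (E : Finset (Fin n × Fin n)) : List ℕ :=
  (List.finRange n).flatMap fun v => (List.finRange n).map fun w => bit ((v, w) ∈ E)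

/-- The characteristic vector of a set of vertices. -/
noncomputable def encodeSet {n : ℕ} (T : Set (Fin n)) : List ℕ :=
  (List.finRange n).map fun v => bit (v ∈ T)

/-- A graph with at least one vertex. -/
structure TriangleInst where
  n : ℕ
  pos : 1 ≤ n
  edges : Finset (Fin n × Fin n)

/-- Detecting whether a graph contains a triangle. -/
noncomputable def triangleDetection : Problem where
  Inst := TriangleInst
  n I := I.n
  k _ := 0
  encode I := I.n :: encodeEdges I.edges
  answer I := [bit (∃ x y z, (x, y) ∈ I.edges ∧ (y, z) ∈ I.edges ∧ (z, x) ∈ I.edges)]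

/-- The Strong Triangle Conjecture for the algorithms in `C`: none of them detects triangles in time
`O(n ^ (3 - ε))`, for any `ε > 0`. -/
def StrongTriangleConjecture (C : Set Prog) : Prop :=
  ∀ ε : ℝ, 0 < ε → ¬ ∃ p ∈ C,
    SolvesInTime p triangleDetection Set.univ fun I => (I.n : ℝ) ^ (3 - ε)

/-! ## Markov decision processes -/

/-- An MDP with vertex set `Fin n`. The vertices outside `random` belong to player 1; a random
vertex chooses uniformly among its successors; each vertex has a successor. -/
structure MDP (n : ℕ) where
  edges : Finset (Fin n × Fin n)
  random : Finset (Fin n)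
  exists_edge : ∀ v, ∃ w, (v, w) ∈ edges

namespace MDP

variable {n : ℕ} (P : MDP n)

/-- Graphs are the MDPs without random vertices. -/
def IsGraph : Prop := P.random = ∅

/-- The set of successors of a vertex. -/
def succ (v : Fin n) : Finset (Fin n) := {w | (v, w) ∈ P.edges}

theorem succ_nonempty (v : Fin n) : (P.succ v).Nonempty := by
  obtain ⟨w, hw⟩ := P.exists_edge v
  exact ⟨w, by simp [succ, hw]⟩

/-- A strategy of player 1 assigns a successor of the last vertex to every finite sequence
`v₀, …, v_m` of vertices that ends in a player 1 vertex (its values on the other sequences are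
irrelevant). -/
structure Strategy where
  move : ∀ m : ℕ, (Finset.Iic m → Fin n) → Fin n
  move_mem : ∀ (m : ℕ) (h : Finset.Iic m → Fin n),
    h ⟨m, by simp⟩ ∉ P.random → (h ⟨m, by simp⟩, move m h) ∈ P.edges

/-- The plays: the infinite paths of the MDP. -/
def plays : Set (ℕ → Fin n) := {ω | ∀ i, (ω i, ω (i + 1)) ∈ P.edges}

variable {P}

/-- The law of the next vertex after the history `h = (v₀, …, v_m)`. -/
noncomputable def Strategy.nextLaw (σ : P.Strategy) (m : ℕ) (h : Finset.Iic m → Fin n) :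
    PMF (Fin n) :=
  if h ⟨m, by simp⟩ ∈ P.random then
    PMF.uniformOfFinset (P.succ (h ⟨m, by simp⟩)) (P.succ_nonempty _)
  else PMF.pure (σ.move m h)

/-- The transition kernels from histories to the next vertex. -/
noncomputable def Strategy.kernel (σ : P.Strategy) (m : ℕ) :
    ProbabilityTheory.Kernel (Finset.Iic m → Fin n) (Fin n) :=
  ProbabilityTheory.Kernel.ofFunOfCountable fun h => (σ.nextLaw m h).toMeasure

instance (σ : P.Strategy) (m : ℕ) : ProbabilityTheory.IsMarkovKernel (σ.kernel m) :=
  ⟨fun h => inferInstanceAs (MeasureTheory.IsProbabilityMeasure (σ.nextLaw m h).toMeasure)⟩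

/-- The law of the infinite path that starts at `v` when player 1 plays `σ`. -/
noncomputable def Strategy.prob (σ : P.Strategy) (v : Fin n) : MeasureTheory.Measure (ℕ → Fin n) :=
  ProbabilityTheory.Kernel.traj (X := fun _ => Fin n) σ.kernel 0 fun _ => v

variable (P)

/-- The almost-sure winning set of an objective. -/
def asWin (ψ : Set (ℕ → Fin n)) : Set (Fin n) := {v | ∃ σ : P.Strategy, σ.prob v ψ = 1}

end MDP

/-- The set of vertices that occur infinitely often. -/
def infSet {n : ℕ} (ω : ℕ → Fin n) : Set (Fin n) := {v | ∃ᶠ i in Filter.atTop, ω i = v}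

namespace MDP

variable {n : ℕ} (P : MDP n)

/-- The Büchi objective of `T`. -/
def buchi (T : Finset (Fin n)) : Set (ℕ → Fin n) := {ω ∈ P.plays | (infSet ω ∩ T).Nonempty}

/-- The coBüchi objective of `T`. -/
def coBuchi (T : Finset (Fin n)) : Set (ℕ → Fin n) := {ω ∈ P.plays | infSet ω ∩ T = ∅}

/-- The Rabin objective of the pairs `(L i, U i)`. -/
def rabin {k : ℕ} (L U : Fin k → Finset (Fin n)) : Set (ℕ → Fin n) :=
  {ω ∈ P.plays | ∃ i, (infSet ω ∩ L i).Nonempty ∧ infSet ω ∩ U i = ∅}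

/-- The winning set of the disjunctive objective of the objectives `ψ i`. -/
def disjObjective {k : ℕ} (ψ : Fin k → Set (ℕ → Fin n)) : Set (Fin n) := P.asWin (⋃ i, ψ i)

/-- The winning set of the disjunctive query of the objectives `ψ i`. -/
def disjQuery {k : ℕ} (ψ : Fin k → Set (ℕ → Fin n)) : Set (Fin n) := ⋃ i, P.asWin (ψ i)

/-- The encoding of an MDP: number of vertices, adjacency matrix, owners of the vertices. -/
noncomputable def encode : List ℕ :=
  n :: (encodeEdges P.edges ++ encodeSet (P.random : Set (Fin n)))

end MDP

/-- The encoding of `k` sets of vertices: their number and their characteristic vectors. -/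
noncomputable def encodeSets {n k : ℕ} (T : Fin k → Finset (Fin n)) : List ℕ :=
  k :: (List.finRange k).flatMap fun i => encodeSet (T i : Set (Fin n))

/-! ## The problems -/

/-- A nonempty MDP with `k` target sets. -/
structure TargetInst where
  n : ℕ
  k : ℕ
  pos : 1 ≤ n
  P : MDP n
  T : Fin k → Finset (Fin n)

/-- A nonempty MDP with `k` Rabin pairs. -/
structure RabinInst where
  n : ℕ
  k : ℕ
  pos : 1 ≤ n
  P : MDP n
  L : Fin k → Finset (Fin n)
  U : Fin k → Finset (Fin n)

/-- Computing the almost-sure winning set in an MDP with a disjunctive Büchi query. -/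
noncomputable def mdpDisjBuchiQuery : Problem where
  Inst := TargetInst
  n I := I.n
  k I := I.k
  encode I := I.P.encode ++ encodeSets I.T
  answer I := encodeSet (I.P.disjQuery fun i => I.P.buchi (I.T i))

/-- Computing the winning set in a graph with a disjunctive coBüchi objective. -/
noncomputable def graphDisjCoBuchiObjective : Problem where
  Inst := {I : TargetInst // I.P.IsGraph}
  n I := I.1.n
  k I := I.1.k
  encode I := I.1.P.encode ++ encodeSets I.1.T
  answer I := encodeSet (I.1.P.disjObjective fun i => I.1.P.coBuchi (I.1.T i))

/-- Computing the almost-sure winning set in an MDP with a disjunctive coBüchi objective. -/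
noncomputable def mdpDisjCoBuchiObjective : Problem where
  Inst := TargetInst
  n I := I.n
  k I := I.k
  encode I := I.P.encode ++ encodeSets I.T
  answer I := encodeSet (I.P.disjObjective fun i => I.P.coBuchi (I.T i))

/-- Computing the almost-sure winning set in an MDP with a disjunctive coBüchi query. -/
noncomputable def mdpDisjCoBuchiQuery : Problem where
  Inst := TargetInst
  n I := I.n
  k I := I.k
  encode I := I.P.encode ++ encodeSets I.T
  answer I := encodeSet (I.P.disjQuery fun i => I.P.coBuchi (I.T i))

/-- Computing the almost-sure winning set in an MDP with a Rabin objective. -/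
noncomputable def mdpRabinObjective : Problem where
  Inst := RabinInst
  n I := I.n
  k I := I.k
  encode I := I.P.encode ++ (encodeSets I.L ++ encodeSets I.U)
  answer I := encodeSet (I.P.asWin (I.P.rabin I.L I.U))

/-- The instances in which `k` and `n` agree up to the factor `a`. -/
def balanced (Q : Problem) (a : ℕ) : Set Q.Inst := {I | Q.n I ≤ a * Q.k I ∧ Q.k I ≤ a * Q.n I}

/-- No algorithm in `C` solves the problem in time `O(n ^ (3 - ε))` or `O((k * n ^ 2) ^ (1 - ε))`,
for any `ε > 0`, not even on the instances with `k = Θ(n)`. (On those instances `k * n ^ 2` is of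
the order `n ^ 3`, and neither bound fails merely because the input is too long to be read.) -/
def NoFastAlgorithm (C : Set Prog) (Q : Problem) : Prop :=
  ∃ a : ℕ, ∀ ε : ℝ, 0 < ε →
    (¬ ∃ p ∈ C, SolvesInTime p Q (balanced Q a) fun I => (Q.n I : ℝ) ^ (3 - ε)) ∧
    (¬ ∃ p ∈ C, SolvesInTime p Q (balanced Q a)
      fun I => ((Q.k I : ℝ) * (Q.n I : ℝ) ^ 2) ^ (1 - ε))

/-! ## Execution with larger words -/

/-! All five bounds are linear-time reductions from triangle detection. A graph on `n` vertices
becomes an instance with `6 * n` vertices and `n` target sets (or pairs) in which vertex `0` wins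
exactly if there is a triangle. The vertices form six layers of `n` copies each. The instance has
size `O(n ^ 2)` and its entries are computable one by one from the adjacency matrix, so producing it
costs `O(n ^ 2)`, which every bound `n ^ (3 - δ)` with `δ ≤ 1` absorbs. A fast algorithm for the
target problem, preceded by this transformation, would refute the conjecture
(`TriangleReduction.noFastAlgorithm`).

For coBüchi, layer 0 leads to layer 1, layers 1 to 4 are joined by copies of the given edges, layer
4 leads back to layer 0, and a sink layer can be entered from everywhere. The `k`-th target set
consists of the sinks and of the vertices of layers 1 and 4 with index other than `k`. Avoiding it
eventually means running round the layers for ever, entering layer 1 and leaving layer 4 at the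
index `k`, that is, tracing a closed walk of three edges through `k`. There are no random vertices,
and one play decides the objective and the query alike. The Rabin objective with all `L i` equal to
the whole vertex set is the same condition.

For Büchi, player 1 picks an index in layer 1, which is random: with probability one half the play
drops at once into the absorbing vertex of that index, and otherwise it follows copies of the edges
for three steps towards the absorbing layer. The `k`-th target is the absorbing vertex of index `k`.
The first outcome forces the picked index to be `k`, and the second one then requires a triangle
through `k`. It matters that this is a query: a single target has to serve both outcomes.

Probability enters only through two facts: almost every path follows the strategy
(`Strategy.ae_follows`), and an event of positive probability meets every objective of probability
one. On the machine side, a small expression language is compiled to programs with explicit bounds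
on time, registers and word size, and one generic program (`guardedTransducer`) evaluates an
expression at every output cell. -/

theorem Exec.mono {B B' : ℕ} (hB : B ≤ B') {p : Prog} {s s' : RamState} {t : ℕ}
    (h : Exec B p s t s') : Exec B' p s t s' := by
  induction h with
  | skip s => exact .skip s
  | const s d c h => exact .const s d c (h.trans_le hB)
  | op s o d a b h => exact .op s o d a b (h.trans_le hB)
  | load s d a h => exact .load s d a (h.trans_le hB)
  | store s a b h => exact .store s a b (h.trans_le hB)
  | seq _ _ ih1 ih2 => exact .seq ih1 ih2
  | ite_lt h _ ih => exact .ite_lt h ih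
  | ite_ge h _ ih => exact .ite_ge h ih
  | loop_ge h => exact .loop_ge h
  | loop_lt h _ _ ih1 ih2 => exact .loop_lt h ih1 ih2

/-! ## Expressions -/

/-- Expressions over four variables (the registers `0, …, 3`) and the memory. -/
inductive RamExpr
  | lit (c : ℕ)
  | var (i : Fin 4)
  | op (o : BinOp) (ho : ∀ x y, o.eval x y ≤ x * y + x + y) (a b : RamExpr)
  | ite (a b p q : RamExpr)
  | load (a : RamExpr)

namespace RamExpr

/-- The value of an expression. -/
def eval (env : Fin 4 → ℕ) (mem : ℕ → ℕ) : RamExpr → ℕ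
  | lit c => c
  | var i => env i
  | op o _ a b => o.eval (a.eval env mem) (b.eval env mem)
  | ite a b p q => if a.eval env mem < b.eval env mem then p.eval env mem else q.eval env mem
  | load a => mem (a.eval env mem)

/-- A number that bounds the running time and the number of registers needed to evaluate an
expression, and the exponent of its growth. -/
def size : RamExpr → ℕ
  | lit c => c + 1
  | var _ => 1
  | op _ _ a b => a.size + b.size + 1
  | ite a b p q => a.size + b.size + p.size + q.size + 1
  | load a => a.size + 1

/-- A program that writes the value of an expression into register `d`, using registers above. -/
def compile : RamExpr → ℕ → Prog
  | lit c, d => .const d c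
  | var i, d => .op .lor d i i
  | op o _ a b, d => .seq (a.compile d) (.seq (b.compile (d + 1)) (.op o d d (d + 1)))
  | ite a b p q, d =>
    .seq (a.compile d) (.seq (b.compile (d + 1)) (.ite d (d + 1) (p.compile d) (q.compile d)))
  | load a, d => .seq (a.compile d) (.load d d)

/-- All variables and memory cells are below `M`. -/
def Bounded (M : ℕ) (env : Fin 4 → ℕ) (mem : ℕ → ℕ) : Prop :=
  2 ≤ M ∧ (∀ i, env i < M) ∧ ∀ a, mem a < M

/-- The bound demanded of an operation says that its value plus one is at most `(x + 1) * (y + 1)`.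
Hence exponents add along subexpressions, and values stay polynomial in `M`; left shifts violate
this and are not available. A load returns to exponent 1, since all memory cells are below `M`. -/
theorem eval_lt {M : ℕ} {env : Fin 4 → ℕ} {mem : ℕ → ℕ} (hM : Bounded M env mem) (e : RamExpr) :
    e.eval env mem < M ^ e.size := by
  obtain ⟨h2, henv, hmem⟩ := hM
  have mono : ∀ {a b : ℕ}, a ≤ b → M ^ a ≤ M ^ b := fun h => Nat.pow_le_pow_right (by omega) h
  induction e with
  | lit c =>
    exact (Nat.lt_pow_self (by omega)).trans_le (mono (by simp [size, eval]))
  | var i => simpa [size, eval] using henv i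
  | op o ho a b iha ihb =>
    simp only [eval, size]
    refine (ho _ _).trans_lt (lt_of_lt_of_le ?_ (mono (Nat.le_succ _)))
    rw [pow_add]
    have := Nat.mul_le_mul (Nat.succ_le_of_lt iha) (Nat.succ_le_of_lt ihb)
    simp only [Nat.succ_eq_add_one, add_mul, mul_add] at this
    omega
  | ite a b p q iha ihb ihp ihq =>
    simp only [eval, size]
    split_ifs
    · exact ihp.trans_le (mono (by omega))
    · exact ihq.trans_le (mono (by omega))
  | load a _ =>
    simp only [eval, size]
    exact (hmem _).trans_le (by simpa using mono (a := 1) (Nat.le_add_left 1 a.size))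

/-- Registers from `d` on serve as an evaluation stack: the left operand rests in `d` while the
right one is evaluated from `d + 1` on. The last clause, that nothing outside a window of length
`e.size` changes, is what lets the induction preserve the left operand and the variables. -/
theorem exec_compile {B M : ℕ} {env : Fin 4 → ℕ} {mem : ℕ → ℕ} (hM : Bounded M env mem)
    (e : RamExpr) : ∀ (d : ℕ) (s : RamState), 4 ≤ d → M ^ e.size ≤ B →
      (∀ i : Fin 4, s.reg i = env i) → s.mem = mem →
      ∃ t s', Exec B (e.compile d) s t s' ∧ t ≤ e.size ∧ s'.reg d = e.eval env mem ∧
        s'.mem = mem ∧ ∀ r, r < d ∨ d + e.size ≤ r → s'.reg r = s.reg r := by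
  have mono : ∀ {a b : ℕ}, a ≤ b → M ^ a ≤ M ^ b :=
    fun h => Nat.pow_le_pow_right (by have := hM.1; omega) h
  induction e with
  | lit c =>
    intro d s hd hB hs hm
    refine ⟨1, _, .const s d c ((eval_lt hM (lit c)).trans_le hB), by simp [size],
      by simp [RamState.setReg, eval], hm, fun r hr => ?_⟩
    have : r ≠ d := by simp only [size] at hr; omega
    simp [RamState.setReg, this]
  | var i =>
    intro d s hd hB hs hm
    have hv : BinOp.lor.eval (s.reg i) (s.reg i) = env i := by simp [BinOp.eval, hs]
    refine ⟨1, _, .op s .lor d i i (by rw [hv]; exact (eval_lt hM (var i)).trans_le hB),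
      by simp [size], by simp [RamState.setReg, eval, hv], hm, fun r hr => ?_⟩
    have : r ≠ d := by simp only [size] at hr; omega
    simp [RamState.setReg, this]
  | op o ho a b iha ihb =>
    intro d s hd hB hs hm
    simp only [size] at hB
    obtain ⟨t1, s1, e1, ht1, hv1, hm1, hr1⟩ := iha d s hd ((mono (by omega)).trans hB) hs hm
    obtain ⟨t2, s2, e2, ht2, hv2, hm2, hr2⟩ := ihb (d + 1) s1 (by omega)
      ((mono (by omega)).trans hB) (fun i => by rw [hr1 _ (by omega), hs]) hm1
    have hd2 : s2.reg d = a.eval env mem := by rw [hr2 _ (by omega), hv1]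
    have hlt := (eval_lt hM (op o ho a b)).trans_le hB
    simp only [eval] at hlt
    refine ⟨_, _, .seq e1 (.seq e2 (.op s2 o d d (d + 1) (by rw [hd2, hv2]; exact hlt))),
      by simp only [size]; omega, by simp [RamState.setReg, hd2, hv2, eval], hm2, fun r hr => ?_⟩
    simp only [size] at hr
    have : r ≠ d := by omega
    simp only [RamState.setReg, ne_eq, this, not_false_eq_true, Function.update_of_ne]
    rw [hr2 _ (by omega), hr1 _ (by omega)]
  | ite a b p q iha ihb ihp ihq =>
    intro d s hd hB hs hm
    simp only [size] at hB
    obtain ⟨t1, s1, e1, ht1, hv1, hm1, hr1⟩ := iha d s hd ((mono (by omega)).trans hB) hs hm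
    obtain ⟨t2, s2, e2, ht2, hv2, hm2, hr2⟩ := ihb (d + 1) s1 (by omega)
      ((mono (by omega)).trans hB) (fun i => by rw [hr1 _ (by omega), hs]) hm1
    have hd2 : s2.reg d = a.eval env mem := by rw [hr2 _ (by omega), hv1]
    have hs2 : ∀ i : Fin 4, s2.reg i = env i := fun i => by
      rw [hr2 _ (by omega), hr1 _ (by omega), hs]
    by_cases hab : a.eval env mem < b.eval env mem
    · obtain ⟨t3, s3, e3, ht3, hv3, hm3, hr3⟩ := ihp d s2 hd ((mono (by omega)).trans hB) hs2 hm2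
      refine ⟨_, _, .seq e1 (.seq e2 (.ite_lt (by rw [hd2, hv2]; exact hab) e3)),
        by simp only [size]; omega, by simp [hv3, eval, hab], hm3, fun r hr => ?_⟩
      simp only [size] at hr
      rw [hr3 _ (by omega), hr2 _ (by omega), hr1 _ (by omega)]
    · obtain ⟨t3, s3, e3, ht3, hv3, hm3, hr3⟩ := ihq d s2 hd ((mono (by omega)).trans hB) hs2 hm2
      refine ⟨_, _, .seq e1 (.seq e2 (.ite_ge (by rw [hd2, hv2]; exact hab) e3)),
        by simp only [size]; omega, by simp [hv3, eval, hab], hm3, fun r hr => ?_⟩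
      simp only [size] at hr
      rw [hr3 _ (by omega), hr2 _ (by omega), hr1 _ (by omega)]
  | load a iha =>
    intro d s hd hB hs hm
    simp only [size] at hB
    obtain ⟨t1, s1, e1, ht1, hv1, hm1, hr1⟩ := iha d s hd ((mono (by omega)).trans hB) hs hm
    have hlt := (eval_lt hM (load a)).trans_le hB
    simp only [eval] at hlt
    refine ⟨_, _, .seq e1 (.load s1 d d (by rw [hv1, hm1]; exact hlt)),
      by simp only [size]; omega, by simp [RamState.setReg, hm1, hv1, eval], hm1, fun r hr => ?_⟩
    simp only [size] at hr
    have : r ≠ d := by omega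
    simp only [RamState.setReg, ne_eq, this, not_false_eq_true, Function.update_of_ne]
    rw [hr1 _ (by omega)]

end RamExpr

/-! ## Commands -/

/-- The variables have the values `env`, the registers from `R` on are zero, the memory is `mem`. -/
def RamState.Matches (R : ℕ) (env : Fin 4 → ℕ) (mem : ℕ → ℕ) (s : RamState) : Prop :=
  (∀ i : Fin 4, s.reg i = env i) ∧ (∀ r, R ≤ r → s.reg r = 0) ∧ s.mem = mem

/-- In time `T` the program takes each state matching `env`, `mem` to one matching `env'`, `mem'`. -/
def Transforms (B R T : ℕ) (p : Prog) (env : Fin 4 → ℕ) (mem : ℕ → ℕ) (env' : Fin 4 → ℕ)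
    (mem' : ℕ → ℕ) : Prop :=
  ∀ s : RamState, s.Matches R env mem →
    ∃ t s', Exec B p s t s' ∧ t ≤ T ∧ s'.Matches R env' mem'

namespace Transforms

open RamExpr

variable {B R M T T' L : ℕ} {p q : Prog} {env env' env'' : Fin 4 → ℕ} {mem mem' mem'' : ℕ → ℕ}

theorem seq (hp : Transforms B R T p env mem env' mem')
    (hq : Transforms B R T' q env' mem' env'' mem'') :
    Transforms B R (T + T') (.seq p q) env mem env'' mem'' := by
  intro s hs
  obtain ⟨t, s1, e1, h1, hs1⟩ := hp s hs
  obtain ⟨t', s2, e2, h2, hs2⟩ := hq s1 hs1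
  exact ⟨_, _, .seq e1 e2, by omega, hs2⟩

/-- Assign the value of `e` to the variable `i`. -/
def _root_.RamExpr.assign (i : Fin 4) (e : RamExpr) : Prog := .seq (e.compile 4) (.op .lor i 4 4)

/-- Store the value of `e` in the memory cell given by `a`. -/
def _root_.RamExpr.store (a e : RamExpr) : Prog :=
  .seq (a.compile 4) (.seq (e.compile 5) (.store 4 5))

/-- `Matches` leaves the registers from `4` up to `R` unconstrained, so evaluation may leave garbage
there. The bound on `R` keeps this garbage below the registers that have to remain zero. The bitwise
or of a register with itself serves as a move. -/
theorem assign (hM : Bounded M env mem) (i : Fin 4) (e : RamExpr) (hB : M ^ e.size ≤ B)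
    (hR : 5 + e.size ≤ R) (hT : e.size + 1 ≤ T)
    (h' : ∀ j, env' j = if j = i then e.eval env mem else env j) :
    Transforms B R T (RamExpr.assign i e) env mem env' mem := by
  intro s hs
  obtain ⟨t, s1, e1, h1, hv, hm, hr⟩ := exec_compile hM e 4 s le_rfl hB hs.1 hs.2.2
  have hv' : BinOp.lor.eval (s1.reg 4) (s1.reg 4) = e.eval env mem := by simp [BinOp.eval, hv]
  refine ⟨_, _, .seq e1 (.op s1 .lor i 4 4 (by rw [hv']; exact (eval_lt hM e).trans_le hB)),
    by omega, fun j => ?_, fun r hrR => ?_, hm⟩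
  · rw [h']
    by_cases hj : j = i
    · simp [hj, RamState.setReg, hv']
    · have : (j : ℕ) ≠ i := fun h => hj (Fin.ext h)
      simp only [RamState.setReg, ne_eq, this, not_false_eq_true, Function.update_of_ne, hj,
        if_false]
      rw [hr _ (by omega), hs.1]
  · have : r ≠ i := by omega
    simp only [RamState.setReg, ne_eq, this, not_false_eq_true, Function.update_of_ne]
    rw [hr _ (by omega), hs.2.1 _ hrR]

theorem store (hM : Bounded M env mem) (a e : RamExpr) (hBa : M ^ a.size ≤ B)
    (hB : M ^ e.size ≤ B) (hRa : 5 + a.size ≤ R) (hR : 5 + e.size ≤ R) :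
    Transforms B R (a.size + e.size + 1) (RamExpr.store a e) env mem env
      (Function.update mem (a.eval env mem) (e.eval env mem)) := by
  intro s hs
  obtain ⟨t, s1, e1, h1, hv, hm, hr⟩ := exec_compile hM a 4 s le_rfl hBa hs.1 hs.2.2
  obtain ⟨t', s2, e2, h2, hv2, hm2, hr2⟩ := exec_compile hM e 5 s1 (by omega) hB
    (fun i => by rw [hr _ (by omega), hs.1]) hm
  have hd : s2.reg 4 = a.eval env mem := by rw [hr2 _ (by omega), hv]
  refine ⟨_, _, .seq e1 (.seq e2 (.store s2 4 5 (by rw [hv2]; exact (eval_lt hM e).trans_le hB))),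
    by omega, fun j => ?_, fun r hrR => ?_, by simp [RamState.setMem, hd, hv2, hm2]⟩
  · simp only [RamState.setMem]
    rw [hr2 _ (by omega), hr _ (by omega), hs.1]
  · simp only [RamState.setMem]
    rw [hr2 _ (by omega), hr _ (by omega), hs.2.1 _ hrR]

/-- While variable `2` is less than variable `3`, execute `store a e` and increment variable `2`. -/
def _root_.RamExpr.fill (a e : RamExpr) : Prog :=
  .loop 2 3 (.seq (RamExpr.store a e)
    (RamExpr.assign 2 (.op .add (fun x y => by simp only [BinOp.eval]; omega) (.var 2) (.lit 1))))

/-- The memory in which the cells from `base` to `base + i` hold the values of `g`. -/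
def filled (mem : ℕ → ℕ) (base : ℕ) (g : ℕ → ℕ) (i : ℕ) : ℕ → ℕ :=
  fun c => if base ≤ c ∧ c < base + i then g (c - base) else mem c

theorem filled_zero (mem : ℕ → ℕ) (base : ℕ) (g : ℕ → ℕ) : filled mem base g 0 = mem := by
  funext c
  exact if_neg (by omega)

theorem filled_of_lt {mem : ℕ → ℕ} {base : ℕ} {g : ℕ → ℕ} {i c : ℕ} (h : c < base) :
    filled mem base g i c = mem c :=
  if_neg (by omega)

theorem filled_succ (mem : ℕ → ℕ) (base : ℕ) (g : ℕ → ℕ) (i : ℕ) :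
    Function.update (filled mem base g i) (base + i) (g i) = filled mem base g (i + 1) := by
  funext c
  by_cases hc : c = base + i
  · subst hc
    simp [filled]
  · simp only [Function.update_of_ne hc, filled]
    exact if_congr (by omega) rfl rfl

theorem filled_lt {base i : ℕ} {g : ℕ → ℕ} (hmem : ∀ c, mem c < M) (hg : ∀ j < i, g j < M) (c : ℕ) :
    filled mem base g i c < M := by
  unfold filled
  split_ifs with h
  · exact hg _ (by omega)
  · exact hmem c

/-- Since `e` may read the memory that is being written, `he` asks for its value in the partially
filled memory. A round costs `a.size + e.size + 1` for the store, 5 for the increment and 1 for the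
test; the final `+ 1` is the failing test. -/
theorem fill {x n base : ℕ} {g : ℕ → ℕ} (a e : RamExpr)
    (hM : Bounded M ![x, n, L, L] mem) (hg : ∀ i < L, g i < M)
    (hBa : M ^ a.size ≤ B) (hB : M ^ e.size ≤ B) (hB4 : M ^ 4 ≤ B)
    (hRa : 5 + a.size ≤ R) (hR : 5 + e.size ≤ R) (hR9 : 9 ≤ R)
    (ha : ∀ i < L, ∀ m, a.eval ![x, n, i, L] m = base + i)
    (he : ∀ i < L, e.eval ![x, n, i, L] (filled mem base g i) = g i)
    (hT : L * (a.size + e.size + 7) + 1 ≤ T) :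
    Transforms B R T (RamExpr.fill a e) ![x, n, 0, L] mem ![x, n, L, L] (filled mem base g L) := by
  -- Induction on the number `k` of remaining rounds, with the first `i` cells already written.
  have main : ∀ k i, i + k = L →
      Transforms B R (k * (a.size + e.size + 7) + 1) (RamExpr.fill a e) ![x, n, i, L]
        (filled mem base g i) ![x, n, L, L] (filled mem base g L) := by
    intro k
    induction k with
    | zero =>
      rintro i hi s hs
      obtain rfl : i = L := by omega
      have h2 := hs.1 2
      have h3 := hs.1 3
      simp only [Matrix.cons_val, Fin.val_two] at h2 h3
      exact ⟨1, s, .loop_ge (by rw [h2]; change ¬ _ < s.reg ((3 : Fin 4) : ℕ); omega), by omega, hs⟩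
    | succ k ih =>
      rintro i hi
      have hb : ∀ m' : ℕ → ℕ, (∀ c, m' c < M) → Bounded M ![x, n, i, L] m' := by
        obtain ⟨h2, h3, -⟩ := hM
        refine fun m' hm' => ⟨h2, fun j => ?_, hm'⟩
        have h0 := h3 0
        have h1 := h3 1
        have hL := h3 3
        simp only [Matrix.cons_val] at h0 h1 hL
        fin_cases j <;> simp only [Fin.mk_one, Fin.reduceFinMk, Fin.zero_eta, Matrix.cons_val] <;>
          omega
      have hb1 := hb _ (filled_lt (base := base) (i := i) hM.2.2 fun j hj => hg j (by omega))
      have hb2 := hb _ (filled_lt (base := base) (i := i + 1) hM.2.2 fun j hj => hg j (by omega))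
      have t1 := store hb1 a e hBa hB hRa hR
      rw [ha i (by omega), he i (by omega), filled_succ] at t1
      have t2 := assign (env' := ![x, n, i + 1, L]) (T := 5) hb2 2
        (.op .add (fun x y => by simp only [BinOp.eval]; omega) (.var 2) (.lit 1))
        (B := B) (R := R) (by simpa [size] using hB4) (by simpa [size] using hR9)
        (by simp [size])
        (fun j => by fin_cases j <;> simp [eval, BinOp.eval])
      have t3 := t1.seq t2
      rintro s hs
      obtain ⟨t, s1, e1, ht, hs1⟩ := t3 s hs
      obtain ⟨t', s2, e2, ht', hs2⟩ := ih (i + 1) (by omega) s1 hs1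
      have h2 := hs.1 2
      have h3 := hs.1 3
      simp only [Matrix.cons_val, Fin.val_two] at h2 h3
      refine ⟨_, s2, .loop_lt (by rw [h2]; change _ < s.reg ((3 : Fin 4) : ℕ); omega) e1 e2, ?_, hs2⟩
      rw [Nat.add_mul]
      omega
  have := main L 0 (by omega)
  rw [filled_zero] at this
  intro s hs
  obtain ⟨t, s', h1, h2, h3⟩ := this s hs
  exact ⟨t, s', h1, h2.trans hT, h3⟩

end Transforms

/-- Set the registers `1, …, k` to zero. -/
def clearRegs : ℕ → Prog
  | 0 => .skip
  | k + 1 => .seq (clearRegs k) (.const (k + 1) 0)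

theorem exec_clearRegs {B : ℕ} (hB : 0 < B) (s : RamState) (k : ℕ) :
    Exec B (clearRegs k) s (k + 1) ⟨fun r => if 1 ≤ r ∧ r ≤ k then 0 else s.reg r, s.mem⟩ := by
  induction k with
  | zero =>
    have h : (⟨fun r => if 1 ≤ r ∧ r ≤ 0 then 0 else s.reg r, s.mem⟩ : RamState) = s := by
      ext r
      · exact if_neg (by omega)
      · rfl
    rw [h]
    exact .skip s
  | succ k ih =>
    have h : (⟨fun r => if 1 ≤ r ∧ r ≤ k + 1 then 0 else s.reg r, s.mem⟩ : RamState) =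
        RamState.setReg ⟨fun r => if 1 ≤ r ∧ r ≤ k then 0 else s.reg r, s.mem⟩ (k + 1) 0 := by
      ext r
      · simp only [RamState.setReg]
        by_cases hr : r = k + 1
        · subst hr; simp
        · rw [Function.update_of_ne hr]
          exact if_congr (by omega) rfl rfl
      · rfl
    rw [h]
    exact .seq ih (.const _ (k + 1) 0 hB)

/-! ## Plays that are consistent with a strategy -/

namespace MDP

open MeasureTheory ProbabilityTheory

variable {n : ℕ} {P : MDP n}

instance (σ : P.Strategy) (v : Fin n) : IsProbabilityMeasure (σ.prob v) := by
  unfold Strategy.prob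
  infer_instance

theorem Strategy.measurableSet_frestrictLe_eq (m : ℕ) (h : Finset.Iic m → Fin n) :
    MeasurableSet {ω : ℕ → Fin n | Preorder.frestrictLe (π := fun _ => Fin n) m ω = h} :=
  (Preorder.measurable_frestrictLe (X := fun _ => Fin n) m) (measurableSet_singleton h)

/-- The probability of a finite history, extended by one vertex. -/
theorem Strategy.prob_history_succ (σ : P.Strategy) (v : Fin n) (m : ℕ)
    (h : Finset.Iic m → Fin n) (w : Fin n) :
    σ.prob v {ω | Preorder.frestrictLe (π := fun _ => Fin n) m ω = h ∧ ω (m + 1) = w} =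
      σ.prob v {ω | Preorder.frestrictLe (π := fun _ => Fin n) m ω = h} * σ.nextLaw m h w := by
  have key := Kernel.partialTraj_compProd_eq_map_traj (X := fun _ => Fin n) (κ := σ.kernel)
    (Nat.zero_le m) (x₀ := fun _ => v)
  rw [← Kernel.traj_map_frestrictLe_apply] at key
  have h1 := congrArg (fun μ => μ ({h} ×ˢ {w})) key
  rw [Measure.map_apply (by fun_prop) (by measurability),
    Measure.compProd_apply_prod (measurableSet_singleton h) (measurableSet_singleton w),
    Measure.restrict_singleton, lintegral_smul_measure, lintegral_dirac,
    Measure.map_apply (by fun_prop) (measurableSet_singleton h)] at h1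
  have h2 : (σ.kernel m h) {w} = σ.nextLaw m h w := by
    exact PMF.toMeasure_apply_singleton _ _ (measurableSet_singleton w)
  rw [h2] at h1
  exact h1.symm

theorem Strategy.prob_start (σ : P.Strategy) (v : Fin n) :
    σ.prob v {ω | Preorder.frestrictLe (π := fun _ => Fin n) 0 ω = fun _ => v} = 1 := by
  have h1 := Kernel.traj_map_frestrictLe_apply (X := fun _ => Fin n) (κ := σ.kernel) 0 0 (fun _ => v)
  have h2 := congrArg (fun μ => μ {fun _ => v}) h1
  simp only [Kernel.partialTraj_self, Kernel.id_apply] at h2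
  rw [Measure.map_apply (by fun_prop) (measurableSet_singleton _),
    Measure.dirac_apply' _ (measurableSet_singleton _)] at h2
  rw [Set.indicator_of_mem (by simp)] at h2
  exact h2

theorem Strategy.ae_start (σ : P.Strategy) (v : Fin n) : ∀ᵐ ω ∂σ.prob v, ω 0 = v := by
  have h := (prob_compl_eq_zero_iff (μ := σ.prob v)
    (Strategy.measurableSet_frestrictLe_eq 0 (fun _ => v))).2 (σ.prob_start v)
  refine measure_mono_null (fun ω hω => ?_) h
  simp only [Set.mem_compl_iff, Set.mem_ofPred_eq] at hω ⊢
  exact fun hh => hω (congrFun hh ⟨0, by simp⟩)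

/-- There are only countably many triples of a time, a history and a next vertex, and each one with
vanishing transition probability describes a null event. -/
theorem Strategy.ae_nextLaw_ne_zero (σ : P.Strategy) (v : Fin n) :
    ∀ᵐ ω ∂σ.prob v, ∀ m,
      σ.nextLaw m (Preorder.frestrictLe (π := fun _ => Fin n) m ω) (ω (m + 1)) ≠ 0 := by
  rw [ae_all_iff]
  intro m
  have h : ∀ᵐ ω ∂σ.prob v, ∀ (h : Finset.Iic m → Fin n) (w : Fin n), σ.nextLaw m h w = 0 →
      ¬ (Preorder.frestrictLe (π := fun _ => Fin n) m ω = h ∧ ω (m + 1) = w) := by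
    rw [ae_all_iff]
    intro h
    rw [ae_all_iff]
    intro w
    by_cases h0 : σ.nextLaw m h w = 0
    · have := σ.prob_history_succ v m h w
      rw [h0, mul_zero] at this
      refine measure_mono_null (fun ω hω => ?_) this
      simp only [Set.mem_compl_iff, Set.mem_ofPred_eq] at hω ⊢
      by_contra hc
      exact hω fun _ => hc
    · exact Filter.Eventually.of_forall fun ω h1 => absurd h1 h0
  filter_upwards [h] with ω hω h0
  exact hω _ _ h0 ⟨rfl, rfl⟩

/-- Almost every path is a play that starts at `v` and follows the moves of the strategy. -/
theorem Strategy.ae_follows (σ : P.Strategy) (v : Fin n) :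
    ∀ᵐ ω ∂σ.prob v, ω ∈ P.plays ∧ ω 0 = v ∧ ∀ m, ω m ∉ P.random →
      ω (m + 1) = σ.move m (Preorder.frestrictLe (π := fun _ => Fin n) m ω) := by
  filter_upwards [σ.ae_start v, σ.ae_nextLaw_ne_zero v] with ω h0 h
  have hmove : ∀ m, ω m ∉ P.random →
      ω (m + 1) = σ.move m (Preorder.frestrictLe (π := fun _ => Fin n) m ω) := by
    intro m hm
    have h1 := h m
    rw [Strategy.nextLaw, if_neg (by exact hm)] at h1
    simpa using h1
  refine ⟨fun m => ?_, h0, hmove⟩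
  by_cases hm : ω m ∈ P.random
  · have h1 := h m
    rw [Strategy.nextLaw, if_pos (by exact hm), PMF.uniformOfFinset_apply] at h1
    have h2 : ω (m + 1) ∈ P.succ (ω m) := by
      by_contra hc
      exact h1 (if_neg hc)
    simpa [succ] using h2
  · rw [hmove m hm]
    exact σ.move_mem m (Preorder.frestrictLe (π := fun _ => Fin n) m ω) hm

/-- The strategy that always moves along `f`. -/
def Strategy.memoryless (f : Fin n → Fin n) (hf : ∀ v, v ∉ P.random → (v, f v) ∈ P.edges) :
    P.Strategy where
  move m h := f (h ⟨m, by simp⟩)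
  move_mem _ _ hr := hf _ hr

/-- In the reductions a triangle lets player 1 win on every play consistent with `f`, whatever the
random vertices do, so no probability has to be computed. -/
theorem mem_asWin_of_memoryless {ψ : Set (ℕ → Fin n)} {v : Fin n} (f : Fin n → Fin n)
    (hf : ∀ v, v ∉ P.random → (v, f v) ∈ P.edges)
    (hψ : ∀ ω ∈ P.plays, ω 0 = v → (∀ m, ω m ∉ P.random → ω (m + 1) = f (ω m)) → ω ∈ ψ) :
    v ∈ P.asWin ψ := by
  refine ⟨Strategy.memoryless f hf, ?_⟩
  have h : ∀ᵐ ω ∂(Strategy.memoryless f hf).prob v, ω ∈ ψ := by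
    filter_upwards [(Strategy.memoryless f hf).ae_follows v] with ω hω
    exact hψ ω hω.1 hω.2.1 hω.2.2
  rw [← measure_univ (μ := (Strategy.memoryless f hf).prob v)]
  exact measure_congr (Filter.eventuallyEq_univ.2 h)

/-- Otherwise `ψ` lies in the complement of `A`, which would then have probability one. Only `A` has
to be measurable: for `ψ` monotonicity of the outer measure suffices. -/
theorem Strategy.exists_mem_of_prob_eq_one {σ : P.Strategy} {v : Fin n} {ψ A : Set (ℕ → Fin n)}
    (hψ : σ.prob v ψ = 1) (hA : MeasurableSet A) (h0 : σ.prob v A ≠ 0) : ∃ ω ∈ ψ, ω ∈ A := by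
  by_contra! hc
  have h1 : σ.prob v Aᶜ = 1 :=
    le_antisymm prob_le_one (hψ ▸ measure_mono fun ω hω => hc ω hω)
  exact h0 ((prob_compl_eq_one_iff hA).1 h1)

theorem exists_play_of_mem_asWin {ψ : Set (ℕ → Fin n)} {v : Fin n} (h : v ∈ P.asWin ψ) :
    ∃ ω ∈ ψ, ω 0 = v := by
  obtain ⟨σ, hσ⟩ := h
  obtain ⟨ω, hω, h1⟩ := Strategy.exists_mem_of_prob_eq_one hσ
    (Strategy.measurableSet_frestrictLe_eq 0 (fun _ => v)) (by rw [σ.prob_start]; simp)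
  exact ⟨ω, hω, congrFun h1 ⟨0, by simp⟩⟩

/-- If an almost-surely winning strategy moves to a random vertex `r` at the start, then the
objective contains a play through each successor of `r`. -/
theorem exists_play_through_of_mem_asWin {ψ : Set (ℕ → Fin n)} {v : Fin n} (hv : v ∉ P.random)
    (h : v ∈ P.asWin ψ) : ∃ r, (v, r) ∈ P.edges ∧
      (r ∈ P.random → ∀ u, (r, u) ∈ P.edges → ∃ ω ∈ ψ, ω 0 = v ∧ ω 1 = r ∧ ω 2 = u) := by
  obtain ⟨σ, hσ⟩ := h
  refine ⟨σ.move 0 fun _ => v, σ.move_mem 0 (fun _ => v) hv, fun hr u hu => ?_⟩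
  set r := σ.move 0 fun _ => v with hrdef
  set h1 : Finset.Iic 1 → Fin n := fun i => if i.1 = 0 then v else r
  -- As `v` belongs to player 1, the history `(v, r)` is certain.
  have e1 : σ.prob v {ω | Preorder.frestrictLe (π := fun _ => Fin n) 1 ω = h1} = 1 := by
    have := σ.prob_history_succ v 0 (fun _ => v) r
    rw [σ.prob_start, Strategy.nextLaw, if_neg (by exact hv), PMF.pure_apply, if_pos hrdef,
      one_mul] at this
    rw [← this]
    congr 1
    ext ω
    simp only [Set.mem_ofPred_eq, funext_iff, Subtype.forall, Finset.mem_Iic]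
    constructor
    · intro hh
      have a0 := hh 0 (by simp)
      have a1 := hh 1 (by simp)
      refine ⟨fun a ha => ?_, by simpa [h1] using a1⟩
      obtain rfl : a = 0 := by omega
      simpa [h1] using a0
    · rintro ⟨a0, a1⟩ a ha
      have := a0 0 (by simp)
      interval_cases a
      · simpa [h1] using this
      · simpa [h1] using a1
  -- The history `(v, r, u)` has probability one over the number of successors of `r`, hence is met
  -- by the objective.
  have e2 := σ.prob_history_succ v 1 h1 u
  rw [e1, one_mul, Strategy.nextLaw, if_pos (by simpa [h1] using hr),
    PMF.uniformOfFinset_apply_of_mem _ (by simpa [h1, succ] using hu)] at e2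
  obtain ⟨ω, hω, hA⟩ := Strategy.exists_mem_of_prob_eq_one hσ
    ((Strategy.measurableSet_frestrictLe_eq 1 h1).inter
      (measurable_pi_apply 2 (measurableSet_singleton u)))
    (by
      change σ.prob v {ω | Preorder.frestrictLe (π := fun _ => Fin n) 1 ω = h1 ∧ ω (1 + 1) = u} ≠ 0
      rw [e2]
      simp)
  have a0 := congrFun hA.1 ⟨0, by simp⟩
  have a1 := congrFun hA.1 ⟨1, by simp⟩
  exact ⟨ω, hω, by simpa [h1] using a0, by simpa [h1] using a1, hA.2⟩

end MDP

/-! ## Linear-time transformations of square matrices -/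

namespace RamExpr

/-- Addition of expressions. -/
def add (a b : RamExpr) : RamExpr := .op .add (fun x y => by simp only [BinOp.eval]; omega) a b

/-- Truncated subtraction of expressions. -/
def sub (a b : RamExpr) : RamExpr := .op .sub (fun x y => by simp only [BinOp.eval]; omega) a b

/-- Multiplication of expressions. -/
def mul (a b : RamExpr) : RamExpr := .op .mul (fun x y => by simp only [BinOp.eval]; omega) a b

/-- Division of expressions. -/
def div (a b : RamExpr) : RamExpr :=
  .op .div (fun x y => by have := Nat.div_le_self x y; simp only [BinOp.eval]; omega) a b

/-- Remainder of expressions. -/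
def mod (a b : RamExpr) : RamExpr :=
  .op .mod (fun x y => by have := Nat.mod_le x y; simp only [BinOp.eval]; omega) a b

variable (env : Fin 4 → ℕ) (mem : ℕ → ℕ)

@[simp] theorem eval_lit (c : ℕ) : (lit c).eval env mem = c := rfl
@[simp] theorem eval_var (i : Fin 4) : (var i).eval env mem = env i := rfl
@[simp] theorem eval_load (a : RamExpr) : (load a).eval env mem = mem (a.eval env mem) := rfl
@[simp] theorem eval_add (a b : RamExpr) :
    (add a b).eval env mem = a.eval env mem + b.eval env mem := rfl
@[simp] theorem eval_sub (a b : RamExpr) :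
    (sub a b).eval env mem = a.eval env mem - b.eval env mem := rfl
@[simp] theorem eval_mul (a b : RamExpr) :
    (mul a b).eval env mem = a.eval env mem * b.eval env mem := rfl
@[simp] theorem eval_div (a b : RamExpr) :
    (div a b).eval env mem = a.eval env mem / b.eval env mem := rfl
@[simp] theorem eval_mod (a b : RamExpr) :
    (mod a b).eval env mem = a.eval env mem % b.eval env mem := rfl
@[simp] theorem eval_ite (a b p q : RamExpr) : (ite a b p q).eval env mem =
    if a.eval env mem < b.eval env mem then p.eval env mem else q.eval env mem := rfl

end RamExpr

open RamExpr

/-- For an input that consists of a number `n` and `n * n` further entries: copy these entries to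
the cells behind the output, write the values of `f` to the output, and delete the copy. Here
`lenE` describes the length of the output. -/
def matrixTransducer (lenE f : RamExpr) : Prog :=
  .seq (RamExpr.assign 0 lenE) <|
  .seq (RamExpr.assign 3 (mul (var 1) (var 1))) <|
  .seq (RamExpr.fill (add (var 0) (var 2)) (load (add (lit 1) (var 2)))) <|
  .seq (RamExpr.assign 2 (lit 0)) <|
  .seq (RamExpr.assign 3 (var 0)) <|
  .seq (RamExpr.fill (var 2) f) <|
  .seq (RamExpr.assign 2 (lit 0)) <|
  .seq (RamExpr.assign 3 (mul (var 1) (var 1))) <|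
  RamExpr.fill (add (var 0) (var 2)) (lit 0)

/-- Apply `matrixTransducer` to the inputs of the right format, and leave the others unchanged. -/
def guardedTransducer (R : ℕ) (lenE f : RamExpr) : Prog :=
  .seq (RamExpr.assign 1 (load (lit 0))) <|
  .seq (RamExpr.assign 3 (add (mul (var 1) (var 1)) (lit 1))) <|
  .seq (.ite 0 3 .skip (.ite 3 0 .skip (matrixTransducer lenE f)))
  (clearRegs R)

/-- The function that `guardedTransducer` computes. -/
def transduce (A : ℕ → ℕ) (F : ℕ → (ℕ → ℕ) → ℕ → ℕ) (x : List ℕ) : List ℕ :=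
  if x.length = x.getD 0 0 * x.getD 0 0 + 1 then
    (List.range (A (x.getD 0 0))).map (F (x.getD 0 0) fun c => x.getD (1 + c) 0)
  else x

theorem forall_fin_four_lt {M a b c d : ℕ} (ha : a < M) (hb : b < M) (hc : c < M) (hd : d < M) :
    ∀ i, (![a, b, c, d] : Fin 4 → ℕ) i < M := by
  intro i
  fin_cases i <;> assumption

section

variable {lenE f : RamExpr} {A : ℕ → ℕ} {F : ℕ → (ℕ → ℕ) → ℕ → ℕ}

/-- The copy starts at cell `A n`, which lies beyond the input because `n * n + 1 ≤ A n`, and behind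
the output, so neither copying nor writing destroys entries still to be read. By `hf` the output
entries depend on the memory only from the copy on. `S` bounds uniformly the cost, the registers and
the word exponent of every command. -/
theorem transforms_matrixTransducer {B R M S X n l : ℕ} {mem : ℕ → ℕ}
    (hA : ∀ env mem, lenE.eval env mem = A (env 1))
    (hf : ∀ n i a mem, f.eval ![a, n, i, a] mem = F n (fun c => mem (a + c)) i)
    (hAn : n * n + 1 ≤ A n) (hX : 2 ≤ X) (hl : l < X) (hn : n < X) (hnn : n * n + 1 < X)
    (hmem : ∀ c, mem c < X) (hmem0 : ∀ c, n * n + 1 ≤ c → mem c = 0)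
    (hM : M = (X ^ (lenE.size + 1)) ^ (f.size + 1))
    (hS : S = lenE.size + f.size + 10) (hB : M ^ S ≤ B) (hR : S + 10 ≤ R) :
    Transforms B R (8 * S + (2 * (n * n) + A n) * (2 * S) + 10) (matrixTransducer lenE f)
      ![l, n, 0, n * n + 1] mem ![A n, n, n * n, n * n]
      (fun c => if c < A n then F n (fun c => mem (1 + c)) c else 0) := by
  have h1X : 1 ≤ X := by omega
  have hAX : A n < X ^ (lenE.size + 1) := by
    have hb : Bounded X ![l, n, 0, n * n + 1] mem :=
      ⟨hX, forall_fin_four_lt hl hn (by omega) hnn, hmem⟩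
    have := eval_lt hb lenE
    rw [hA] at this
    exact this.trans_le (Nat.pow_le_pow_right h1X (Nat.le_succ _))
  -- Two levels of growth: `M₀` bounds the variables once the output length is known, and `M`, a
  -- power of `M₀`, bounds the values of `f` computed from them.
  set M₀ := X ^ (lenE.size + 1) with hM₀
  have hXM₀ : X ≤ M₀ := by
    simpa using Nat.pow_le_pow_right h1X (Nat.le_add_left 1 lenE.size)
  have hM₀M : M₀ ≤ M := by
    rw [hM]
    simpa using Nat.pow_le_pow_right (show 1 ≤ M₀ by omega) (Nat.le_add_left 1 f.size)
  have h1M : 1 ≤ M := by omega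
  have hBe : ∀ k, k ≤ S → M ^ k ≤ B := fun k hk => (Nat.pow_le_pow_right h1M hk).trans hB
  set mem1 := Transforms.filled mem (A n) (fun i => mem (1 + i)) (n * n) with hmem1
  have hmem1lt : ∀ c, mem1 c < M₀ :=
    Transforms.filled_lt (fun c => (hmem c).trans_le hXM₀) fun j _ => (hmem _).trans_le hXM₀
  -- This also holds beyond the matrix, where both sides are zero.
  have hcopy : ∀ c, mem1 (A n + c) = mem (1 + c) := by
    intro c
    simp only [hmem1, Transforms.filled]
    split_ifs with h
    · congr 2; omega
    · rw [hmem0 _ (by omega), hmem0 _ (by omega)]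
  set g : ℕ → ℕ := F n fun c => mem (1 + c) with hg
  have hgeval : ∀ i m, (∀ c, m (A n + c) = mem (1 + c)) → f.eval ![A n, n, i, A n] m = g i := by
    intro i m hm
    rw [hf]
    simp only [hm, hg]
  have hglt : ∀ i < A n, g i < M := by
    intro i hi
    rw [← hgeval i mem1 hcopy, hM]
    refine (eval_lt ⟨by omega, forall_fin_four_lt hAX ?_ ?_ hAX, hmem1lt⟩ f).trans_le
      (Nat.pow_le_pow_right (by omega) (Nat.le_succ _))
    · omega
    · omega
  set mem2 := Transforms.filled mem1 0 g (A n) with hmem2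
  have hmemM : ∀ c, mem c < M := fun c => by have := hmem c; omega
  have hmem1M : ∀ c, mem1 c < M := fun c => (hmem1lt c).trans_le hM₀M
  have hmem2M : ∀ c, mem2 c < M := Transforms.filled_lt hmem1M hglt
  have bd : ∀ {a b c d : ℕ} {m : ℕ → ℕ}, a < M → b < M → c < M → d < M → (∀ e, m e < M) →
      Bounded M ![a, b, c, d] m := fun ha hb hc hd hm =>
    ⟨by omega, forall_fin_four_lt ha hb hc hd, hm⟩
  have s1 : Transforms B R S (RamExpr.assign 0 lenE) ![l, n, 0, n * n + 1] mem
      ![A n, n, 0, n * n + 1] mem :=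
    .assign (bd (by omega) (by omega) (by omega) (by omega) hmemM) 0 lenE (hBe _ (by omega))
      (by omega) (by omega) (fun j => by rw [hA]; fin_cases j <;> rfl)
  have s2 : Transforms B R S (RamExpr.assign 3 (mul (var 1) (var 1))) ![A n, n, 0, n * n + 1] mem
      ![A n, n, 0, n * n] mem :=
    .assign (bd (by omega) (by omega) (by omega) (by omega) hmemM) 3 _
      (hBe _ (by simp only [size, mul]; omega))
      (by simp only [size, mul]; omega) (by simp only [size, mul]; omega)
      (fun j => by fin_cases j <;> rfl)
  have s3 : Transforms B R (n * n * (2 * S) + 1)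
      (RamExpr.fill (add (var 0) (var 2)) (load (add (lit 1) (var 2))))
      ![A n, n, 0, n * n] mem ![A n, n, n * n, n * n] mem1 :=
    .fill (base := A n) (g := fun i => mem (1 + i)) _ _
      (bd (by omega) (by omega) (by omega) (by omega) hmemM) (fun i _ => hmemM _)
      (hBe _ (by simp only [size, add]; omega)) (hBe _ (by simp only [size, add]; omega))
      (hBe _ (by omega)) (by simp only [size, add]; omega) (by simp only [size, add]; omega)
      (by omega) (fun i hi m => by simp)
      (fun i hi => by
        change Transforms.filled mem (A n) (fun i => mem (1 + i)) i (1 + i) = _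
        exact Transforms.filled_of_lt (by omega))
      (Nat.add_le_add_right (Nat.mul_le_mul_left _ (by simp only [size, add]; omega)) 1)
  have s4 : Transforms B R S (RamExpr.assign 2 (lit 0)) ![A n, n, n * n, n * n] mem1
      ![A n, n, 0, n * n] mem1 :=
    .assign (bd (by omega) (by omega) (by omega) (by omega) hmem1M) 2 _
      (hBe _ (by simp only [size]; omega))
      (by simp only [size]; omega) (by simp only [size]; omega)
      (fun j => by fin_cases j <;> rfl)
  have s5 : Transforms B R S (RamExpr.assign 3 (var 0)) ![A n, n, 0, n * n] mem1
      ![A n, n, 0, A n] mem1 :=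
    .assign (bd (by omega) (by omega) (by omega) (by omega) hmem1M) 3 _
      (hBe _ (by simp only [size]; omega))
      (by simp only [size]; omega) (by simp only [size]; omega)
      (fun j => by fin_cases j <;> rfl)
  have s6 : Transforms B R (A n * (2 * S) + 1) (RamExpr.fill (var 2) f)
      ![A n, n, 0, A n] mem1 ![A n, n, A n, A n] mem2 :=
    .fill (base := 0) (g := g) _ _
      (bd (by omega) (by omega) (by omega) (by omega) hmem1M) hglt
      (hBe _ (by simp only [size]; omega)) (hBe _ (by omega))
      (hBe _ (by omega)) (by simp only [size]; omega) (by omega)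
      (by omega) (fun i hi m => by simp)
      -- The outputs written so far occupy cells below `A n` and leave the copy intact.
      (fun i hi => hgeval i _ fun c => by
        rw [← hcopy]
        exact if_neg (by omega))
      (Nat.add_le_add_right (Nat.mul_le_mul_left _ (by simp only [size]; omega)) 1)
  have s7 : Transforms B R S (RamExpr.assign 2 (lit 0)) ![A n, n, A n, A n] mem2
      ![A n, n, 0, A n] mem2 :=
    .assign (bd (by omega) (by omega) (by omega) (by omega) hmem2M) 2 _
      (hBe _ (by simp only [size]; omega))
      (by simp only [size]; omega) (by simp only [size]; omega)
      (fun j => by fin_cases j <;> rfl)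
  have s8 : Transforms B R S (RamExpr.assign 3 (mul (var 1) (var 1))) ![A n, n, 0, A n] mem2
      ![A n, n, 0, n * n] mem2 :=
    .assign (bd (by omega) (by omega) (by omega) (by omega) hmem2M) 3 _
      (hBe _ (by simp only [size, mul]; omega))
      (by simp only [size, mul]; omega) (by simp only [size, mul]; omega)
      (fun j => by fin_cases j <;> rfl)
  have s9 : Transforms B R (n * n * (2 * S) + 1)
      (RamExpr.fill (add (var 0) (var 2)) (lit 0))
      ![A n, n, 0, n * n] mem2 ![A n, n, n * n, n * n]
      (Transforms.filled mem2 (A n) (fun _ => 0) (n * n)) :=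
    .fill (base := A n) (g := fun _ => 0) _ _
      (bd (by omega) (by omega) (by omega) (by omega) hmem2M) (fun i _ => by omega)
      (hBe _ (by simp only [size, add]; omega)) (hBe _ (by simp only [size]; omega))
      (hBe _ (by omega)) (by simp only [size, add]; omega) (by simp only [size]; omega)
      (by omega) (fun i hi m => by simp) (fun i hi => by simp)
      (Nat.add_le_add_right (Nat.mul_le_mul_left _ (by simp only [size, add]; omega)) 1)
  have hfinal : Transforms.filled mem2 (A n) (fun _ => 0) (n * n) =
      fun c => if c < A n then g c else 0 := by
    funext c
    simp only [Transforms.filled, hmem2, hmem1]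
    by_cases hc : c < A n
    · rw [if_neg (by omega), if_pos (by omega), if_pos hc]
      rfl
    · rw [if_neg hc]
      split_ifs with h1 h2
      · rfl
      · omega
      · exact hmem0 _ (by omega)
  rw [hfinal] at s9
  intro s hs
  obtain ⟨t, s', he, ht, hm⟩ :=
    (s1.seq (s2.seq (s3.seq (s4.seq (s5.seq (s6.seq (s7.seq (s8.seq s9)))))))) s hs
  refine ⟨t, s', he, ht.trans ?_, hm⟩
  rw [Nat.add_mul, Nat.mul_assoc 2 (n * n)]
  omega

/-- A linear-time transformation has to halt properly on every admissible input, not only on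
encodings of graphs; hence the test of the length. Entries are at most the length, so `n` and the
memory are below `X = x.length + 2`, and all intermediate values are below a fixed power of `X`. -/
theorem exec_guardedTransducer {K : ℕ}
    (hA : ∀ env mem, lenE.eval env mem = A (env 1))
    (hf : ∀ n i a mem, f.eval ![a, n, i, a] mem = F n (fun c => mem (a + c)) i)
    (hAn : ∀ n, n * n + 1 ≤ A n) (hK : ∀ n, A n ≤ K * (n * n + 1)) :
    ∃ (r : Prog) (K' c : ℕ), ∀ x : List ℕ, (∀ e ∈ x, e ≤ x.length) → ∃ t,
      Exec ((x.length + 2) ^ c) r (RamState.init x) t (RamState.init (transduce A F x)) ∧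
        t ≤ K' * (x.length + 1) := by
  set S := lenE.size + f.size + 10 with hS
  set q := (lenE.size + 1) * (f.size + 1) with hq
  refine ⟨guardedTransducer (S + 10) lenE f, 100 * (S + 1) * (K + 1), q * S, fun x hx => ?_⟩
  set X := x.length + 2 with hX
  set n := x.getD 0 0 with hn
  set mem : ℕ → ℕ := fun i => x.getD i 0 with hmem
  have hmemX : ∀ i, mem i ≤ x.length := by
    intro i
    simp only [hmem]
    by_cases hi : i < x.length
    · rw [List.getD_eq_getElem _ _ hi]
      exact hx _ (List.getElem_mem hi)
    · rw [List.getD_eq_default _ _ (by omega)]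
      omega
  have hnX : n ≤ x.length := hmemX 0
  have h1X : 1 ≤ X := by omega
  have hqpos : 1 ≤ q := Nat.mul_pos (Nat.succ_pos _) (Nat.succ_pos _)
  have hSB : ∀ k, k ≤ S → X ^ k ≤ X ^ (q * S) := fun k hk =>
    Nat.pow_le_pow_right h1X (hk.trans (Nat.le_mul_of_pos_left _ hqpos))
  have hinit : (RamState.init x).Matches (S + 10) ![x.length, 0, 0, 0] mem := by
    refine ⟨fun i => ?_, fun r hr => if_neg (by omega), rfl⟩
    fin_cases i <;> simp [RamState.init]
  have s1 : Transforms (X ^ (q * S)) (S + 10) S (RamExpr.assign 1 (load (lit 0)))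
      ![x.length, 0, 0, 0] mem ![x.length, n, 0, 0] mem :=
    .assign (M := X) ⟨by omega, forall_fin_four_lt (by omega) (by omega) (by omega) (by omega),
        fun c => by have := hmemX c; omega⟩ 1 _
      (hSB _ (by simp only [size]; omega)) (by simp only [size]; omega)
      (by simp only [size]; omega) (fun j => by fin_cases j <;> rfl)
  have s2 : Transforms (X ^ (q * S)) (S + 10) S
      (RamExpr.assign 3 (add (mul (var 1) (var 1)) (lit 1)))
      ![x.length, n, 0, 0] mem ![x.length, n, 0, n * n + 1] mem :=
    .assign (M := X) ⟨by omega, forall_fin_four_lt (by omega) (by omega) (by omega) (by omega),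
        fun c => by have := hmemX c; omega⟩ 3 _
      (hSB _ (by simp only [size, add, mul]; omega)) (by simp only [size, add, mul]; omega)
      (by simp only [size, add, mul]; omega) (fun j => by fin_cases j <;> rfl)
  obtain ⟨t, s, he, ht, hs⟩ := (s1.seq s2) _ hinit
  have hr0 : s.reg 0 = x.length := hs.1 0
  have hr3 : s.reg 3 = n * n + 1 := hs.1 3
  have hpos : 0 < X ^ (q * S) := Nat.pow_pos (by omega)
  suffices h : ∃ t' s' env', Exec (X ^ (q * S))
      (.ite 0 3 .skip (.ite 3 0 .skip (matrixTransducer lenE f))) s t' s' ∧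
      t' ≤ 8 * S + (2 * x.length + K * x.length) * (2 * S) + 12 ∧
      s'.Matches (S + 10) env' (fun i => (transduce A F x).getD i 0) ∧
      env' 0 = (transduce A F x).length by
    obtain ⟨t', s', env', he', ht', hs', henv'⟩ := h
    cases he with
    | seq e1 e2 =>
    -- The final state must be an initial state for the output exactly, so all scratch registers are
    -- zeroed; register `0` already holds the output length.
    have hclear : Exec (X ^ (q * S)) (clearRegs (S + 10)) s' (S + 10 + 1)
        (RamState.init (transduce A F x)) := by
      convert exec_clearRegs hpos s' (S + 10) using 1
      ext r
      · simp only [RamState.init]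
        by_cases h0 : r = 0
        · subst h0
          simpa [henv'] using (hs'.1 0).symm
        · rw [if_neg h0]
          by_cases hr : r ≤ S + 10
          · rw [if_pos (by omega)]
          · rw [if_neg (by omega), hs'.2.1 _ (by omega)]
      · exact congrFun hs'.2.2.symm _
    refine ⟨_, .seq e1 (.seq e2 (.seq he' hclear)), ?_⟩
    · have h1 : (2 * x.length + K * x.length) * (2 * S) ≤
          100 * S * (K + 1) * x.length := by
        have h : 100 * S * (K + 1) * x.length = (2 * x.length + K * x.length) * (2 * S) +
            (98 * (K * x.length * S) + 96 * (x.length * S)) := by ring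
        omega
      have h2 : 20 * S + 40 ≤ 100 * (S + 1) * (K + 1) := by
        have h : 100 * (S + 1) * (K + 1) = 100 * (K * S) + 100 * K + 100 * S + 100 := by ring
        omega
      have h3 : 100 * (S + 1) * (K + 1) * (x.length + 1) =
          100 * S * (K + 1) * x.length + 100 * (K + 1) * x.length + 100 * (S + 1) * (K + 1) := by
        ring
      omega
  by_cases hlen : x.length = n * n + 1
  · have s3 := transforms_matrixTransducer (B := X ^ (q * S)) (R := S + 10) (X := X) (n := n)
      (l := x.length) (mem := mem) hA hf (hAn n) (by omega) (by omega) (by omega) (by omega)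
      (fun c => by have := hmemX c; omega)
      (fun c hc => List.getD_eq_default _ _ (by omega)) rfl hS
      (by rw [← pow_mul, ← pow_mul, hq, Nat.mul_assoc]) le_rfl
    obtain ⟨t', s', he', ht', hs'⟩ := s3 s hs
    have hy : transduce A F x = (List.range (A n)).map (F n fun c => mem (1 + c)) := if_pos hlen
    refine ⟨_, s', ![A n, n, n * n, n * n], .ite_ge (by omega) (.ite_ge (by omega) he'), ?_, ?_, ?_⟩
    · have h1 := hK n
      rw [← hlen] at h1
      have h2 : (2 * (n * n) + A n) * (2 * S) ≤ (2 * x.length + K * x.length) * (2 * S) :=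
        Nat.mul_le_mul_right _ (by omega)
      omega
    · convert hs' using 1
      funext i
      rw [hy]
      split_ifs with hi
      · rw [List.getD_eq_getElem _ _ (by simpa using hi), List.getElem_map, List.getElem_range]
      · rw [List.getD_eq_default _ _ (by simpa using hi)]
    · rw [hy, List.length_map, List.length_range]
      rfl
  · have hy : transduce A F x = x := if_neg hlen
    rw [hy]
    rcases Nat.lt_or_gt_of_ne hlen with h | h
    · exact ⟨_, s, _, .ite_lt (by omega) (.skip s), by omega, hs, rfl⟩
    · exact ⟨_, s, _, .ite_ge (by omega) (.ite_lt (by omega) (.skip s)), by omega, hs, rfl⟩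

end

/-! ## Reductions from triangle detection -/

/-- Row-major order: position `v * m + w` has quotient `v` and remainder `w`. This turns nested
encodings into functions of a single index, the form that a transducer computes. -/
theorem List.flatMap_range_map_range {α : Type*} (n m : ℕ) (g : ℕ → ℕ → α) :
    ((List.range n).flatMap fun v => (List.range m).map (g v)) =
      (List.range (n * m)).map fun j => g (j / m) (j % m) := by
  induction n with
  | zero => simp
  | succ n ih =>
    rw [List.range_succ, List.flatMap_append, ih, Nat.succ_mul, List.range_add, List.map_append]
    congr 1
    simp only [List.flatMap_cons, List.flatMap_nil, List.append_nil, List.map_map]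
    refine List.map_congr_left fun a ha => ?_
    have ha' : a < m := by simpa using ha
    simp only [Function.comp_apply]
    rw [Nat.mul_comm, Nat.mul_add_div (by omega), Nat.div_eq_of_lt ha', Nat.mul_add_mod,
      Nat.mod_eq_of_lt ha', Nat.add_zero]

theorem List.map_finRange {α : Type*} (n : ℕ) (g : ℕ → α) :
    (List.finRange n).map (fun i : Fin n => g i) = (List.range n).map g := by
  conv_rhs => rw [← List.map_coe_finRange_eq_range, List.map_map]
  rfl

theorem List.flatMap_finRange_map_finRange {α : Type*} (n m : ℕ) (g : ℕ → ℕ → α) :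
    ((List.finRange n).flatMap fun v : Fin n => (List.finRange m).map fun w : Fin m => g v w) =
      (List.range (n * m)).map fun j => g (j / m) (j % m) := by
  rw [← List.flatMap_range_map_range, List.flatMap, List.flatMap, ← List.map_finRange n]
  simp only [← List.map_finRange m]

theorem encodeEdges_eq {n : ℕ} (E : Finset (Fin n × Fin n)) (g : ℕ → ℕ → ℕ)
    (h : ∀ v w : Fin n, bit ((v, w) ∈ E) = g v w) :
    encodeEdges E = (List.range (n * n)).map fun j => g (j / n) (j % n) := by
  rw [encodeEdges, ← List.flatMap_finRange_map_finRange n n g]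
  simp only [h]

theorem encodeSet_eq {n : ℕ} (T : Set (Fin n)) (g : ℕ → ℕ) (h : ∀ v : Fin n, bit (v ∈ T) = g v) :
    encodeSet T = (List.range n).map g := by
  rw [encodeSet, ← List.map_finRange n g]
  simp only [h]

theorem encodeSets_eq {n k : ℕ} (T : Fin k → Finset (Fin n)) (g : ℕ → ℕ → ℕ)
    (h : ∀ (i : Fin k) (v : Fin n), bit (v ∈ T i) = g i v) :
    encodeSets T = k :: (List.range (k * n)).map fun j => g (j / n) (j % n) := by
  rw [encodeSets, ← List.flatMap_finRange_map_finRange k n g]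
  simp only [encodeSet, Finset.mem_coe, h]

/-- The start vertex of the reductions has index `0`, so the first entry of the output answers the
triangle question. -/
theorem encodeSet_eq_cons {n : ℕ} (hn : 0 < n) (T : Set (Fin n)) :
    ∃ l, encodeSet T = bit (⟨0, hn⟩ ∈ T) :: l := by
  obtain ⟨m, rfl⟩ := Nat.exists_eq_succ_of_ne_zero hn.ne'
  exact ⟨_, by rw [encodeSet, List.finRange_succ, List.map_cons]; rfl⟩

theorem bit_congr {p q : Prop} (h : p ↔ q) : bit p = bit q := by rw [propext h]

theorem bit_le_one (p : Prop) : bit p ≤ 1 := by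
  unfold bit
  split_ifs <;> omega

namespace TriangleInst

/-- The edge relation of a graph, as a relation on numbers. -/
def Adj (I : TriangleInst) (i j : ℕ) : Prop :=
  ∃ (hi : i < I.n) (hj : j < I.n), (⟨i, hi⟩, ⟨j, hj⟩) ∈ I.edges

/-- The existence of a triangle. -/
def HasTriangle (I : TriangleInst) : Prop :=
  ∃ x y z, (x, y) ∈ I.edges ∧ (y, z) ∈ I.edges ∧ (z, x) ∈ I.edges

theorem hasTriangle_iff (I : TriangleInst) :
    I.HasTriangle ↔ ∃ x y z, I.Adj x y ∧ I.Adj y z ∧ I.Adj z x := by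
  constructor
  · rintro ⟨x, y, z, h1, h2, h3⟩
    exact ⟨x, y, z, ⟨x.2, y.2, h1⟩, ⟨y.2, z.2, h2⟩, ⟨z.2, x.2, h3⟩⟩
  · rintro ⟨x, y, z, ⟨hx, hy, h1⟩, ⟨_, hz, h2⟩, ⟨_, _, h3⟩⟩
    exact ⟨⟨x, hx⟩, ⟨y, hy⟩, ⟨z, hz⟩, h1, h2, h3⟩

theorem encode_eq (I : TriangleInst) : triangleDetection.encode I =
    I.n :: (List.range (I.n * I.n)).map fun j => bit (I.Adj (j / I.n) (j % I.n)) := by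
  change I.n :: encodeEdges I.edges = _
  rw [encodeEdges_eq I.edges fun v w => bit (I.Adj v w)]
  exact fun v w => bit_congr ⟨fun h => ⟨v.2, w.2, h⟩, fun ⟨_, _, h⟩ => h⟩

theorem length_encode (I : TriangleInst) :
    (triangleDetection.encode I).length = I.n * I.n + 1 := by
  simp [encode_eq]

theorem le_length_encode (I : TriangleInst) :
    ∀ e ∈ triangleDetection.encode I, e ≤ (triangleDetection.encode I).length := by
  intro e he
  rw [length_encode]
  rw [encode_eq, List.mem_cons, List.mem_map] at he
  rcases he with rfl | ⟨j, -, rfl⟩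
  · have := Nat.le_mul_self I.n
    omega
  · exact (bit_le_one _).trans (by omega)

end TriangleInst

/-! ### Transfer of lower bounds along reductions -/

/-- A reduction from triangle detection that is computed by a matrix transducer. -/
structure TriangleReduction (Q : Problem) where
  lenE : RamExpr
  f : RamExpr
  A : ℕ → ℕ
  F : ℕ → (ℕ → ℕ) → ℕ → ℕ
  K : ℕ
  eval_lenE : ∀ env mem, lenE.eval env mem = A (env 1)
  eval_f : ∀ n i a mem, f.eval ![a, n, i, a] mem = F n (fun c => mem (a + c)) i
  lt_A : ∀ n, n * n + 1 ≤ A n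
  A_le : ∀ n, A n ≤ K * (n * n + 1)
  inst : TriangleInst → Q.Inst
  n_inst : ∀ I, Q.n (inst I) = 6 * I.n
  k_inst : ∀ I, Q.k (inst I) = I.n
  answer_inst : ∀ I, ∃ l, Q.answer (inst I) = bit I.HasTriangle :: l
  encode_inst : ∀ I, Q.encode (inst I) =
    (List.range (A I.n)).map (F I.n fun j => bit (j < I.n * I.n ∧ I.Adj (j / I.n) (j % I.n)))

namespace TriangleReduction

variable {Q : Problem}

theorem transduce_encode (red : TriangleReduction Q) (I : TriangleInst) :
    transduce red.A red.F (triangleDetection.encode I) = Q.encode (red.inst I) := by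
  have h0 : (triangleDetection.encode I).getD 0 0 = I.n := by simp [I.encode_eq]
  rw [transduce, if_pos (by rw [h0, I.length_encode]), red.encode_inst, h0]
  congr 2
  funext j
  rw [I.encode_eq, Nat.add_comm, List.getD_cons_succ]
  -- Cells beyond the input read as zero, which is what the guard `j < I.n * I.n` in `encode_inst`
  -- records.
  by_cases hj : j < I.n * I.n
  · rw [List.getD_eq_getElem _ _ (by simpa using hj)]
    simp [hj]
  · rw [List.getD_eq_default _ _ (by simpa using hj)]
    simp [hj, bit]

theorem inst_mem_balanced (red : TriangleReduction Q) (I : TriangleInst) : red.inst I ∈ balanced Q 6 := by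
  refine ⟨?_, ?_⟩
  · rw [red.n_inst, red.k_inst]
  · rw [red.n_inst, red.k_inst]
    omega

/-- The composed program costs `O(n ^ 2)` for the transformation plus the time on the produced
instance; `δ ≤ 1` makes the former negligible. Its words suffice because the produced input is only
polynomially longer. -/
theorem exists_solvesInTime (red : TriangleReduction Q) {C : Set Prog}
    (hC : ClosedUnderLinearTimePreprocessing C)
    {p : Prog} (hp : p ∈ C) {τ : Q.Inst → ℝ} (hsolve : SolvesInTime p Q (balanced Q 6) τ)
    {δ D : ℝ} (hδ : δ ≤ 1) (hτ0 : ∀ I, 0 ≤ τ (red.inst I))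
    (hτ : ∀ I, τ (red.inst I) ≤ D * (I.n : ℝ) ^ (3 - δ)) :
    ∃ p' ∈ C, SolvesInTime p' triangleDetection Set.univ fun I => (I.n : ℝ) ^ (3 - δ) := by
  obtain ⟨r, K₁, c₁, hr⟩ := exec_guardedTransducer red.eval_lenE red.eval_f red.lt_A red.A_le
  obtain ⟨K, c, hK⟩ := hsolve
  refine ⟨.seq r p, hC r p ⟨K₁, c₁, fun x hx => ?_⟩ hp, |K| * D + 3 * K₁,
    c₁ + (red.K + 2) * c, fun (I : TriangleInst) _ => ?_⟩
  · obtain ⟨t, ht⟩ := hr x hx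
    exact ⟨_, t, ht⟩
  · obtain ⟨t₁, he₁, ht₁⟩ := hr _ I.le_length_encode
    obtain ⟨t₂, s, he₂, hout, ht₂⟩ := hK _ (red.inst_mem_balanced I)
    rw [red.transduce_encode] at he₁
    rw [I.length_encode] at he₁ ht₁ ⊢
    set X := I.n * I.n + 1 + 2 with hX
    have hX1 : 1 ≤ X := by omega
    have hlen : (Q.encode (red.inst I)).length + 2 ≤ X ^ (red.K + 2) := by
      have h1 : (Q.encode (red.inst I)).length ≤ red.K * (I.n * I.n + 1) := by
        rw [red.encode_inst]
        simpa using red.A_le I.n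
      have h2 : red.K + 1 ≤ X ^ (red.K + 1) := by
        exact (Nat.lt_pow_self (show 1 < 2 by omega)).le.trans
          (Nat.pow_le_pow_left (by omega) _)
      calc (Q.encode (red.inst I)).length + 2 ≤ (red.K + 1) * X := by
            rw [hX, Nat.add_mul, Nat.mul_add red.K]
            omega
        _ ≤ X ^ (red.K + 1) * X := Nat.mul_le_mul_right _ h2
        _ = X ^ (red.K + 2) := (pow_succ _ _).symm
    refine ⟨t₁ + t₂, s, .seq (he₁.mono (Nat.pow_le_pow_right hX1 (by omega)))
      (he₂.mono ((Nat.pow_le_pow_left hlen c).trans ?_)), ?_, ?_⟩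
    · rw [← pow_mul]
      exact Nat.pow_le_pow_right hX1 (by omega)
    · obtain ⟨l, hl⟩ := red.answer_inst I
      intro i hi
      obtain rfl : i = 0 := by
        change i < 1 at hi
        omega
      have h0 := hout 0 (by simp [hl])
      simp only [hl, List.getElem_cons_zero] at h0
      exact h0
    · have hn1 : (1 : ℝ) ≤ I.n := by exact_mod_cast I.pos
      have h2 : (I.n : ℝ) * I.n ≤ (I.n : ℝ) ^ (3 - δ) := by
        calc (I.n : ℝ) * I.n = (I.n : ℝ) ^ (2 : ℝ) := by
              rw [Real.rpow_two, sq]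
          _ ≤ _ := Real.rpow_le_rpow_of_exponent_le hn1 (by linarith)
      have h3 : (1 : ℝ) ≤ (I.n : ℝ) ^ (3 - δ) := Real.one_le_rpow hn1 (by linarith)
      have h4 : (t₁ : ℝ) ≤ K₁ * (I.n * I.n + 1 + 1) := by exact_mod_cast ht₁
      -- The constant `K` is an arbitrary real and might be negative, hence the absolute value.
      have h5 : K * τ (red.inst I) ≤ |K| * (D * (I.n : ℝ) ^ (3 - δ)) :=
        (mul_le_mul_of_nonneg_right (le_abs_self K) (hτ0 I)).trans
          (mul_le_mul_of_nonneg_left (hτ I) (abs_nonneg K))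
      have h6 : (K₁ : ℝ) * (I.n * I.n + 1 + 1) ≤ K₁ * (3 * (I.n : ℝ) ^ (3 - δ)) :=
        mul_le_mul_of_nonneg_left (by linarith) (Nat.cast_nonneg _)
      push_cast
      change (t₁ : ℝ) + t₂ ≤ (|K| * D + 3 * K₁) * (I.n : ℝ) ^ (3 - δ)
      linarith

/-- A problem to which triangle detection reduces has no fast algorithm. -/
theorem noFastAlgorithm (red : TriangleReduction Q) {C : Set Prog}
    (hC : ClosedUnderLinearTimePreprocessing C)
    (hSTC : StrongTriangleConjecture C) : NoFastAlgorithm C Q := by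
  refine ⟨6, fun ε hε => ⟨?_, ?_⟩⟩
  all_goals
    rintro ⟨p, hp, hsolve⟩
    have hδ1 : min ε 1 ≤ 1 := min_le_right ε 1
    have hδε : min ε 1 ≤ ε := min_le_left ε 1
    -- Cutting `ε` down to at most 1 keeps the exponent `3 - δ` at least 2, so that it covers the
    -- cost of the preprocessing.
    refine hSTC (min ε 1) (lt_min hε one_pos) ?_
  · refine red.exists_solvesInTime hC hp hsolve (D := 6 ^ (3 - min ε 1)) hδ1
      (fun I => by positivity) fun I => ?_
    have hn1 : (1 : ℝ) ≤ I.n := by exact_mod_cast I.pos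
    rw [red.n_inst, ← Real.mul_rpow (by norm_num) (by positivity)]
    push_cast
    exact Real.rpow_le_rpow_of_exponent_le (by linarith) (by linarith)
  · refine red.exists_solvesInTime hC hp hsolve (D := 36 ^ (1 - min ε 1 / 3)) hδ1
      (fun I => by positivity) fun I => ?_
    have hn1 : (1 : ℝ) ≤ I.n := by exact_mod_cast I.pos
    have hn3 : (1 : ℝ) ≤ (I.n : ℝ) ^ (3 : ℝ) := Real.one_le_rpow hn1 (by norm_num)
    -- On the produced instances `k * n ^ 2` is 36 times the cube of the number of vertices of the
    -- given graph, so saving `ε` in its exponent saves at least `δ / 3` there, that is, `δ` in the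
    -- exponent of `n`.
    have h1 : (I.n : ℝ) ^ (3 - min ε 1) = ((I.n : ℝ) ^ (3 : ℝ)) ^ (1 - min ε 1 / 3) := by
      rw [← Real.rpow_mul (by positivity)]
      congr 1
      ring
    have h2 : (I.n : ℝ) * (6 * I.n) ^ 2 = 36 * (I.n : ℝ) ^ (3 : ℝ) := by
      rw [show (3 : ℝ) = ((3 : ℕ) : ℝ) by norm_num, Real.rpow_natCast]
      ring
    rw [red.n_inst, red.k_inst, h1, ← Real.mul_rpow (by norm_num) (by positivity)]
    push_cast
    rw [h2]
    exact Real.rpow_le_rpow_of_exponent_le (by linarith) (by linarith)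

end TriangleReduction

/-! ## The layered graph for coBüchi objectives -/

/-- Each of the finitely many vertices of `T` has a last visit, and the finitely many times have a
maximum. -/
theorem eventually_notMem_of_infSet_inter_eq_empty {n : ℕ} {ω : ℕ → Fin n} {T : Finset (Fin n)}
    (h : infSet ω ∩ T = ∅) : ∃ N, ∀ i, N ≤ i → ω i ∉ T := by
  have h1 : ∀ v ∈ T, ∀ᶠ i in Filter.atTop, ω i ≠ v := by
    intro v hv
    have h2 : v ∉ infSet ω := fun h3 => (Set.ext_iff.1 h v).1 ⟨h3, hv⟩
    exact Filter.not_frequently.1 h2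
  have h2 := (Filter.eventually_all_finset T).2 h1
  obtain ⟨N, hN⟩ := Filter.eventually_atTop.1 h2
  exact ⟨N, fun i hi hT => hN i hi _ hT rfl⟩

namespace TriangleInst

variable (I : TriangleInst)

theorem Adj.lt {I : TriangleInst} {i j : ℕ} (h : I.Adj i j) : i < I.n ∧ j < I.n :=
  ⟨h.1, h.2.1⟩

/-- The edges of the graph on six layers: an initial layer, four layers that trace a triangle and
return to the initial layer, and a sink. Vertex `v` is the vertex `v / 6` of layer `v % 6`. -/
def CycleEdge (v w : ℕ) : Prop :=
  w % 6 = 5 ∨ (v % 6 = 0 ∧ w % 6 = 1) ∨ (v % 6 = 4 ∧ w % 6 = 0) ∨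
    (1 ≤ v % 6 ∧ v % 6 ≤ 3 ∧ w % 6 = v % 6 + 1 ∧ I.Adj (v / 6) (w / 6))

/-- The sink, and the vertices that start or end a path at a vertex other than `k`. -/
def cycleTarget (k v : ℕ) : Prop :=
  v % 6 = 5 ∨ ((v % 6 = 1 ∨ v % 6 = 4) ∧ v / 6 ≠ k)

open Classical in
/-- The graph given by `CycleEdge`. -/
noncomputable def cycleGraph : MDP (6 * I.n) where
  edges := {p | I.CycleEdge p.1 p.2}
  random := ∅
  exists_edge v := ⟨⟨5, by have := I.pos; omega⟩, by
    rw [Finset.mem_filter]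
    exact ⟨Finset.mem_univ _, Or.inl rfl⟩⟩

open Classical in
/-- The sets given by `cycleTarget`. -/
noncomputable def cycleTargets (k : Fin I.n) : Finset (Fin (6 * I.n)) := {v | cycleTarget k v}

/-- The vertex `0` of layer `0`. -/
def start : Fin (6 * I.n) := ⟨0, by have := I.pos; omega⟩

theorem mem_cycleGraph_edges (v w : Fin (6 * I.n)) :
    (v, w) ∈ I.cycleGraph.edges ↔ I.CycleEdge v w := by
  simp [cycleGraph]

theorem mem_cycleTargets (k : Fin I.n) (v : Fin (6 * I.n)) :
    v ∈ I.cycleTargets k ↔ cycleTarget k v := by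
  simp [cycleTargets]

/-- Once the play avoids the target for ever, it stays out of the sinks and passes layers 1 and 4
only at index `k`; the three edges between these layers close up. The starting vertex plays no role.
-/
theorem hasTriangle_of_play {ω : ℕ → Fin (6 * I.n)} (hω : ω ∈ I.cycleGraph.plays) (k : Fin I.n)
    (hk : infSet ω ∩ I.cycleTargets k = ∅) : I.HasTriangle := by
  obtain ⟨N, hN⟩ := eventually_notMem_of_infSet_inter_eq_empty hk
  have hedge : ∀ i, I.CycleEdge (ω i) (ω (i + 1)) := fun i =>
    (I.mem_cycleGraph_edges _ _).1 (hω i)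
  have htarget : ∀ i, N ≤ i → ¬ cycleTarget k (ω i) := fun i hi h =>
    hN i hi ((I.mem_cycleTargets k _).2 h)
  have h5 : ∀ i, N ≤ i → (ω i : ℕ) % 6 ≠ 5 := fun i hi h => htarget i hi (Or.inl h)
  have hidx : ∀ i, N ≤ i → ((ω i : ℕ) % 6 = 1 ∨ (ω i : ℕ) % 6 = 4) → (ω i : ℕ) / 6 = k :=
    fun i hi h => by
      by_contra hc
      exact htarget i hi (Or.inr ⟨h, hc⟩)
  -- Away from the sinks the layers are traversed cyclically with period 5.
  have hstep : ∀ i, N ≤ i → (ω (i + 1) : ℕ) % 6 = ((ω i : ℕ) % 6 + 1) % 5 := by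
    intro i hi
    have h1 := h5 (i + 1) (by omega)
    rcases hedge i with h | ⟨h, h'⟩ | ⟨h, h'⟩ | ⟨h, h', h'', -⟩ <;> omega
  have hadj : ∀ i, N ≤ i → 1 ≤ (ω i : ℕ) % 6 → (ω i : ℕ) % 6 ≤ 3 →
      I.Adj ((ω i : ℕ) / 6) ((ω (i + 1) : ℕ) / 6) := by
    intro i hi h1 h3
    have h2 := h5 (i + 1) (by omega)
    rcases hedge i with h | ⟨h, h'⟩ | ⟨h, h'⟩ | ⟨-, -, -, h⟩
    · omega
    · omega
    · omega
    · exact h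
  -- Layer 1 is reached from any of the five layers within four steps.
  obtain ⟨i, hi, h1⟩ : ∃ i, N ≤ i ∧ (ω i : ℕ) % 6 = 1 := by
    have a0 := hstep N le_rfl
    have a1 := hstep (N + 1) (by omega)
    have a2 := hstep (N + 1 + 1) (by omega)
    have a3 := hstep (N + 1 + 1 + 1) (by omega)
    have b0 := h5 N le_rfl
    have : (ω N : ℕ) % 6 < 6 := Nat.mod_lt _ (by omega)
    by_cases c1 : (ω N : ℕ) % 6 = 1
    · exact ⟨N, le_rfl, c1⟩
    by_cases c0 : (ω N : ℕ) % 6 = 0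
    · exact ⟨N + 1, by omega, by omega⟩
    by_cases c4 : (ω N : ℕ) % 6 = 4
    · exact ⟨N + 1 + 1, by omega, by omega⟩
    by_cases c3 : (ω N : ℕ) % 6 = 3
    · exact ⟨N + 1 + 1 + 1, by omega, by omega⟩
    · exact ⟨N + 1 + 1 + 1 + 1, by omega, by omega⟩
  have a0 := hstep i hi
  have a1 := hstep (i + 1) (by omega)
  have a2 := hstep (i + 1 + 1) (by omega)
  have e0 := hadj i hi (by omega) (by omega)
  have e1 := hadj (i + 1) (by omega) (by omega) (by omega)
  have e2 := hadj (i + 1 + 1) (by omega) (by omega) (by omega)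
  rw [hidx i hi (Or.inl h1)] at e0
  rw [hidx (i + 1 + 1 + 1) (by omega) (Or.inr (by omega))] at e2
  exact (hasTriangle_iff I).2 ⟨_, _, _, e0, e1, e2⟩

/-- Player 1 repeats the cycle through the triangle. Leaving `ψ` arbitrary lets one argument serve
the objective, the query and the Rabin condition; the latter also needs a vertex seen infinitely
often, for which `I.start` is offered. -/
theorem start_mem_asWin_cycleGraph (h : I.HasTriangle) : ∃ k : Fin I.n,
    ∀ ψ : Set (ℕ → Fin (6 * I.n)), (∀ ω ∈ I.cycleGraph.plays, I.start ∈ infSet ω →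
      infSet ω ∩ I.cycleTargets k = ∅ → ω ∈ ψ) → I.start ∈ I.cycleGraph.asWin ψ := by
  obtain ⟨x, y, z, hxy, hyz, hzx⟩ := I.hasTriangle_iff.1 h
  obtain ⟨hx, hy⟩ := hxy.lt
  have hz := hzx.lt.1
  refine ⟨⟨x, hx⟩, fun ψ hψ => ?_⟩
  -- The vertices of the cycle lie in five different layers, so they are distinct even if `x`, `y`,
  -- `z` are not, and a memoryless choice suffices. Off the cycle it moves to the sink `5`.
  let c : ℕ → ℕ := fun v =>
    if v = 0 then 6 * x + 1 else if v = 6 * x + 1 then 6 * y + 2 else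
    if v = 6 * y + 2 then 6 * z + 3 else if v = 6 * z + 3 then 6 * x + 4 else
    if v = 6 * x + 4 then 0 else 5
  have hc : ∀ v, c v < 6 * I.n := by
    intro v
    simp only [c]
    split_ifs <;> omega
  have hcedge : ∀ v, I.CycleEdge v (c v) := by
    intro v
    simp only [c]
    split_ifs with h0 h1 h2 h3 h4
    · exact Or.inr (Or.inl ⟨by omega, by omega⟩)
    · refine Or.inr (Or.inr (Or.inr ⟨by omega, by omega, by omega, ?_⟩))
      convert hxy using 1 <;> omega
    · refine Or.inr (Or.inr (Or.inr ⟨by omega, by omega, by omega, ?_⟩))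
      convert hyz using 1 <;> omega
    · refine Or.inr (Or.inr (Or.inr ⟨by omega, by omega, by omega, ?_⟩))
      convert hzx using 1 <;> omega
    · exact Or.inr (Or.inr (Or.inl ⟨by omega, by omega⟩))
    · exact Or.inl (by omega)
  refine MDP.mem_asWin_of_memoryless (fun v => ⟨c v, hc v⟩)
    (fun v _ => (I.mem_cycleGraph_edges _ _).2 (hcedge v)) fun ω hω h0 hstep => ?_
  have hstep' : ∀ m, (ω (m + 1) : ℕ) = c (ω m) := fun m => by
    rw [hstep m (by simp [cycleGraph])]
  have h0' : (ω 0 : ℕ) = 0 := by rw [h0]; rfl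
  have hcycle : ∀ m, (ω (5 * m) : ℕ) = 0 ∧ (ω (5 * m + 1) : ℕ) = 6 * x + 1 ∧
      (ω (5 * m + 2) : ℕ) = 6 * y + 2 ∧ (ω (5 * m + 3) : ℕ) = 6 * z + 3 ∧
      (ω (5 * m + 4) : ℕ) = 6 * x + 4 ∧ (ω (5 * m + 5) : ℕ) = 0 := by
    have key : ∀ m, (ω m : ℕ) = 0 → (ω (m + 1) : ℕ) = 6 * x + 1 ∧
        (ω (m + 2) : ℕ) = 6 * y + 2 ∧ (ω (m + 3) : ℕ) = 6 * z + 3 ∧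
        (ω (m + 4) : ℕ) = 6 * x + 4 ∧ (ω (m + 5) : ℕ) = 0 := by
      intro m hm
      have a1 : (ω (m + 1) : ℕ) = 6 * x + 1 := by rw [hstep', hm]; exact if_pos rfl
      have a2 : (ω (m + 2) : ℕ) = 6 * y + 2 := by
        rw [hstep', a1]
        simp only [c]
        rw [if_neg (by omega), if_true]
      have a3 : (ω (m + 3) : ℕ) = 6 * z + 3 := by
        rw [hstep', a2]
        simp only [c]
        rw [if_neg (by omega), if_neg (by omega), if_true]
      have a4 : (ω (m + 4) : ℕ) = 6 * x + 4 := by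
        rw [hstep', a3]
        simp only [c]
        rw [if_neg (by omega), if_neg (by omega), if_neg (by omega), if_true]
      have a5 : (ω (m + 5) : ℕ) = 0 := by
        rw [hstep', a4]
        simp only [c]
        rw [if_neg (by omega), if_neg (by omega), if_neg (by omega), if_neg (by omega), if_true]
      exact ⟨a1, a2, a3, a4, a5⟩
    intro m
    induction m with
    | zero => exact ⟨h0', key 0 h0'⟩
    | succ m ih => exact ⟨ih.2.2.2.2.2, key _ ih.2.2.2.2.2⟩
  refine hψ ω hω (Filter.frequently_atTop.2 fun N => ⟨5 * N, by omega, ?_⟩) ?_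
  · exact Fin.ext (hcycle N).1
  · rw [Set.eq_empty_iff_forall_notMem]
    rintro v ⟨hv, hT⟩
    obtain ⟨i, rfl⟩ := hv.exists
    rw [Finset.mem_coe, mem_cycleTargets] at hT
    obtain ⟨m, hi⟩ : ∃ m, i = 5 * m ∨ i = 5 * m + 1 ∨ i = 5 * m + 2 ∨ i = 5 * m + 3 ∨
        i = 5 * m + 4 := ⟨i / 5, by omega⟩
    obtain ⟨a0, a1, a2, a3, a4, -⟩ := hcycle m
    unfold cycleTarget at hT
    rcases hi with rfl | rfl | rfl | rfl | rfl <;> simp only at hT <;> omega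

theorem start_mem_asWin_cycleGraph_iff {ψ : Set (ℕ → Fin (6 * I.n))}
    (h1 : ∀ ω ∈ ψ, ω ∈ I.cycleGraph.plays ∧ ∃ k, infSet ω ∩ I.cycleTargets k = ∅)
    (h2 : ∀ ω ∈ I.cycleGraph.plays, I.start ∈ infSet ω → ∀ k,
      infSet ω ∩ I.cycleTargets k = ∅ → ω ∈ ψ) :
    I.start ∈ I.cycleGraph.asWin ψ ↔ I.HasTriangle := by
  constructor
  · intro h
    obtain ⟨ω, hω, -⟩ := MDP.exists_play_of_mem_asWin h
    obtain ⟨hp, k, hk⟩ := h1 ω hω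
    exact I.hasTriangle_of_play hp k hk
  · intro h
    obtain ⟨k, hk⟩ := I.start_mem_asWin_cycleGraph h
    exact hk ψ fun ω hω hs hT => h2 ω hω hs k hT

theorem start_mem_disjObjective_coBuchi_iff :
    I.start ∈ I.cycleGraph.disjObjective (fun k => I.cycleGraph.coBuchi (I.cycleTargets k)) ↔
      I.HasTriangle := by
  refine I.start_mem_asWin_cycleGraph_iff (fun ω hω => ?_) fun ω hω _ k hk => ?_
  · obtain ⟨k, h1, h2⟩ := Set.mem_iUnion.1 hω
    exact ⟨h1, k, h2⟩
  · exact Set.mem_iUnion.2 ⟨k, hω, hk⟩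

theorem start_mem_disjQuery_coBuchi_iff :
    I.start ∈ I.cycleGraph.disjQuery (fun k => I.cycleGraph.coBuchi (I.cycleTargets k)) ↔
      I.HasTriangle := by
  constructor
  · intro h
    obtain ⟨k, hk⟩ := Set.mem_iUnion.1 h
    obtain ⟨ω, hω, -⟩ := MDP.exists_play_of_mem_asWin hk
    exact I.hasTriangle_of_play hω.1 k hω.2
  · intro h
    obtain ⟨k, hk⟩ := I.start_mem_asWin_cycleGraph h
    exact Set.mem_iUnion.2 ⟨k, hk _ fun ω hω _ hT => ⟨hω, hT⟩⟩

/-- With the whole vertex set as every `L i`, the first half of a Rabin pair only asks that some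
vertex recur, and the pair becomes a coBüchi condition. -/
theorem start_mem_asWin_rabin_iff :
    I.start ∈ I.cycleGraph.asWin (I.cycleGraph.rabin (fun _ => Finset.univ) I.cycleTargets) ↔
      I.HasTriangle := by
  refine I.start_mem_asWin_cycleGraph_iff (fun ω hω => ?_) fun ω hω hs k hk => ?_
  · obtain ⟨h1, k, -, h2⟩ := hω
    exact ⟨h1, k, h2⟩
  · exact ⟨hω, k, ⟨I.start, hs, by simp⟩, hk⟩

/-! ## The layered MDP for Büchi objectives -/

/-- The edges of the MDP on six layers: the initial layer, a random layer that leads either to the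
first of three layers that trace a triangle or immediately to the absorbing last layer, which is
also where the triangles end. -/
def AbsorbingEdge (v w : ℕ) : Prop :=
  (v % 6 = 0 ∧ w % 6 = 1) ∨ (v % 6 = 1 ∧ v / 6 = w / 6 ∧ (w % 6 = 2 ∨ w % 6 = 5)) ∨
    (2 ≤ v % 6 ∧ v = w) ∨
    (2 ≤ v % 6 ∧ v % 6 ≤ 4 ∧ w % 6 = v % 6 + 1 ∧ I.Adj (v / 6) (w / 6))

open Classical in
/-- The MDP given by `AbsorbingEdge`. -/
noncomputable def absorbingMDP : MDP (6 * I.n) where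
  edges := {p | I.AbsorbingEdge p.1 p.2}
  random := {v | (v : ℕ) % 6 = 1}
  exists_edge v := by
    have hv := v.2
    have : (v : ℕ) % 6 < 6 := Nat.mod_lt _ (by omega)
    simp only [Finset.mem_filter, Finset.mem_univ, true_and]
    by_cases h0 : (v : ℕ) % 6 = 0
    · exact ⟨⟨1, by omega⟩, Or.inl ⟨h0, rfl⟩⟩
    by_cases h1 : (v : ℕ) % 6 = 1
    · exact ⟨⟨v + 1, by omega⟩, Or.inr (Or.inl ⟨h1, by simp only; omega, by simp only; omega⟩)⟩
    · exact ⟨v, Or.inr (Or.inr (Or.inl ⟨by omega, rfl⟩))⟩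

/-- The vertex `k` of the last layer. -/
def absorbingTargets (k : Fin I.n) : Finset (Fin (6 * I.n)) := {⟨6 * k + 5, by omega⟩}

theorem mem_absorbingMDP_edges (v w : Fin (6 * I.n)) :
    (v, w) ∈ I.absorbingMDP.edges ↔ I.AbsorbingEdge v w := by
  simp [absorbingMDP]

theorem mem_absorbingMDP_random (v : Fin (6 * I.n)) :
    v ∈ I.absorbingMDP.random ↔ (v : ℕ) % 6 = 1 := by
  simp [absorbingMDP]

theorem mem_absorbingTargets (k : Fin I.n) (v : Fin (6 * I.n)) :
    v ∈ I.absorbingTargets k ↔ (v : ℕ) = 6 * k + 5 := by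
  simp [absorbingTargets, Fin.ext_iff]

theorem exists_ge_of_mem_buchi {ω : ℕ → Fin (6 * I.n)} {k : Fin I.n}
    (h : ω ∈ I.absorbingMDP.buchi (I.absorbingTargets k)) (N : ℕ) :
    ∃ i, N ≤ i ∧ (ω i : ℕ) = 6 * k + 5 := by
  obtain ⟨v, hv, hT⟩ := h.2
  rw [Finset.mem_coe, mem_absorbingTargets] at hT
  obtain ⟨i, hi, rfl⟩ := Filter.frequently_atTop.1 hv N
  exact ⟨i, hi, hT⟩

theorem absorbing_const {ω : ℕ → Fin (6 * I.n)} (hω : ω ∈ I.absorbingMDP.plays) {N x : ℕ}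
    (hN : (ω N : ℕ) = 6 * x + 5) : ∀ i, N ≤ i → (ω i : ℕ) = 6 * x + 5 := by
  intro i hi
  induction i, hi using Nat.le_induction with
  | base => exact hN
  | succ i hi ih =>
    rcases (I.mem_absorbingMDP_edges _ _).1 (hω i) with h | h | h | h <;> omega

/-- Both outcomes at the random vertex `r` chosen first have positive probability, so each is
realised by a winning play for the same `k`. The direct drop into the last layer identifies the
index of `r` as `k`; the other play gives the triangle. -/
theorem hasTriangle_of_start_mem_asWin_buchi {k : Fin I.n}
    (h : I.start ∈ I.absorbingMDP.asWin (I.absorbingMDP.buchi (I.absorbingTargets k))) :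
    I.HasTriangle := by
  obtain ⟨r, hr, hplay⟩ := MDP.exists_play_through_of_mem_asWin
    (by rw [mem_absorbingMDP_random]; simp [start]) h
  rw [mem_absorbingMDP_edges] at hr
  have hr1 : (r : ℕ) % 6 = 1 := by
    have h0 : ((I.start : Fin (6 * I.n)) : ℕ) = 0 := rfl
    rcases hr with h | h | h | h <;> omega
  have hrlt := r.2
  have hrk : (r : ℕ) / 6 = k := by
    obtain ⟨ω, hω, -, -, h2⟩ := hplay ((I.mem_absorbingMDP_random r).2 hr1)
      ⟨6 * (r / 6) + 5, by omega⟩ ((I.mem_absorbingMDP_edges _ _).2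
        (Or.inr (Or.inl ⟨hr1, by simp only; omega, by simp only; omega⟩)))
    obtain ⟨i, hi, hik⟩ := I.exists_ge_of_mem_buchi hω 2
    have := I.absorbing_const hω.1 (x := r / 6) (by rw [h2]) i hi
    omega
  obtain ⟨ω, hω, -, -, h2⟩ := hplay ((I.mem_absorbingMDP_random r).2 hr1)
    ⟨6 * (r / 6) + 2, by omega⟩ ((I.mem_absorbingMDP_edges _ _).2
      (Or.inr (Or.inl ⟨hr1, by simp only; omega, by simp only; omega⟩)))
  -- After the random choice the play is at the end of a walk from `k` in the given graph, whose
  -- length is determined by the layer; self-loops preserve this.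
  have inv : ∀ i, 2 ≤ i → (ω i : ℕ) = 6 * k + 2 ∨
      ((ω i : ℕ) % 6 = 3 ∧ I.Adj k ((ω i : ℕ) / 6)) ∨
      ((ω i : ℕ) % 6 = 4 ∧ ∃ y, I.Adj k y ∧ I.Adj y ((ω i : ℕ) / 6)) ∨
      ((ω i : ℕ) % 6 = 5 ∧ ∃ y z, I.Adj k y ∧ I.Adj y z ∧ I.Adj z ((ω i : ℕ) / 6)) := by
    intro i hi
    induction i, hi using Nat.le_induction with
    | base => exact Or.inl (by rw [h2, ← hrk])
    | succ i hi ih =>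
      rcases (I.mem_absorbingMDP_edges _ _).1 (hω.1 i) with h | h | ⟨-, h⟩ | ⟨h1, h2, h3, h4⟩
      · omega
      · omega
      · rwa [← h]
      · rcases ih with a | ⟨a, b⟩ | ⟨a, y, b, c⟩ | ⟨a, -⟩
        · rw [show (ω i : ℕ) / 6 = k by omega] at h4
          exact Or.inr (Or.inl ⟨by omega, h4⟩)
        · exact Or.inr (Or.inr (Or.inl ⟨by omega, _, b, h4⟩))
        · exact Or.inr (Or.inr (Or.inr ⟨by omega, _, _, b, c, h4⟩))
        · omega
  obtain ⟨i, hi, hik⟩ := I.exists_ge_of_mem_buchi hω 2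
  rcases inv i hi with a | ⟨a, -⟩ | ⟨a, -⟩ | ⟨-, y, z, b, c, d⟩
  · omega
  · omega
  · omega
  · rw [show (ω i : ℕ) / 6 = k by omega] at d
    exact I.hasTriangle_iff.2 ⟨_, _, _, b, c, d⟩

/-- Picking `x` first, one outcome is absorbed at `x` immediately and the other after tracing the
triangle, so every consistent play reaches the same absorbing vertex. -/
theorem start_mem_asWin_buchi (h : I.HasTriangle) : ∃ k : Fin I.n,
    I.start ∈ I.absorbingMDP.asWin (I.absorbingMDP.buchi (I.absorbingTargets k)) := by
  obtain ⟨x, y, z, hxy, hyz, hzx⟩ := I.hasTriangle_iff.1 h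
  obtain ⟨hx, hy⟩ := hxy.lt
  have hz := hzx.lt.1
  refine ⟨⟨x, hx⟩, ?_⟩
  let c : ℕ → ℕ := fun v =>
    if v % 6 = 0 then 6 * x + 1 else if v = 6 * x + 2 then 6 * y + 3 else
    if v = 6 * y + 3 then 6 * z + 4 else if v = 6 * z + 4 then 6 * x + 5 else v
  have hc : ∀ v, v < 6 * I.n → c v < 6 * I.n := by
    intro v hv
    simp only [c]
    split_ifs <;> omega
  have hcedge : ∀ v, v % 6 ≠ 1 → I.AbsorbingEdge v (c v) := by
    intro v hv
    simp only [c]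
    split_ifs with h0 h1 h2 h3
    · exact Or.inl ⟨h0, by omega⟩
    · refine Or.inr (Or.inr (Or.inr ⟨by omega, by omega, by omega, ?_⟩))
      convert hxy using 1 <;> omega
    · refine Or.inr (Or.inr (Or.inr ⟨by omega, by omega, by omega, ?_⟩))
      convert hyz using 1 <;> omega
    · refine Or.inr (Or.inr (Or.inr ⟨by omega, by omega, by omega, ?_⟩))
      convert hzx using 1 <;> omega
    · exact Or.inr (Or.inr (Or.inl ⟨by omega, rfl⟩))
  refine MDP.mem_asWin_of_memoryless (fun v => ⟨c v, hc v v.2⟩)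
    (fun v hv => (I.mem_absorbingMDP_edges _ _).2
      (hcedge v fun h => hv ((I.mem_absorbingMDP_random v).2 h))) fun ω hω h0 hstep => ?_
  have hstep' : ∀ m, (ω m : ℕ) % 6 ≠ 1 → (ω (m + 1) : ℕ) = c (ω m) := fun m hm => by
    rw [hstep m fun h => hm ((I.mem_absorbingMDP_random _).1 h)]
  have h0' : (ω 0 : ℕ) = 0 := by rw [h0]; rfl
  have a1 : (ω 1 : ℕ) = 6 * x + 1 := by rw [hstep' 0 (by omega), h0']; rfl
  have a2 : (ω 2 : ℕ) = 6 * x + 2 ∨ (ω 2 : ℕ) = 6 * x + 5 := by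
    rcases (I.mem_absorbingMDP_edges _ _).1 (hω 1) with h | h | h | h <;>
      simp only [Nat.reduceAdd] at h <;> omega
  have a5 : ∃ N, (ω N : ℕ) = 6 * x + 5 := by
    rcases a2 with a2 | a2
    · have a3 : (ω 3 : ℕ) = 6 * y + 3 := by
        rw [hstep' 2 (by omega), a2]
        simp only [c]
        rw [if_neg (by omega), if_true]
      have a4 : (ω 4 : ℕ) = 6 * z + 4 := by
        rw [hstep' 3 (by omega), a3]
        simp only [c]
        rw [if_neg (by omega), if_neg (by omega), if_true]
      refine ⟨5, ?_⟩
      rw [hstep' 4 (by omega), a4]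
      simp only [c]
      rw [if_neg (by omega), if_neg (by omega), if_neg (by omega), if_true]
    · exact ⟨2, a2⟩
  obtain ⟨N, hN⟩ := a5
  refine ⟨hω, ⟨6 * x + 5, by omega⟩, Filter.Eventually.frequently ?_, ?_⟩
  · exact Filter.eventually_atTop.2 ⟨N, fun i hi => Fin.ext (I.absorbing_const hω hN i hi)⟩
  · rw [Finset.mem_coe, mem_absorbingTargets]

theorem start_mem_disjQuery_buchi_iff :
    I.start ∈ I.absorbingMDP.disjQuery
      (fun k => I.absorbingMDP.buchi (I.absorbingTargets k)) ↔ I.HasTriangle := by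
  constructor
  · intro h
    obtain ⟨k, hk⟩ := Set.mem_iUnion.1 h
    exact I.hasTriangle_of_start_mem_asWin_buchi hk
  · intro h
    exact Set.mem_iUnion.2 (I.start_mem_asWin_buchi h)

end TriangleInst

/-! ## Encodings of the layered instances -/

/-- The first `a` values of `f`, followed by the values of `g`. -/
def appendFun (a : ℕ) (f g : ℕ → ℕ) (j : ℕ) : ℕ := if j < a then f j else g (j - a)

theorem map_range_append (a b : ℕ) (f g : ℕ → ℕ) :
    (List.range (a + b)).map (appendFun a f g) = (List.range a).map f ++ (List.range b).map g := by
  rw [List.range_add, List.map_append, List.map_map]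
  congr 1
  · refine List.map_congr_left fun j hj => ?_
    exact if_pos (List.mem_range.1 hj)
  · refine List.map_congr_left fun j _ => ?_
    simp [appendFun]

theorem map_range_one_add (b c : ℕ) (g : ℕ → ℕ) :
    (List.range (1 + b)).map (appendFun 1 (fun _ => c) g) = c :: (List.range b).map g := by
  rw [map_range_append]
  rfl

namespace RamExpr

/-- The expression for `appendFun`. -/
def append (a : RamExpr) (f g : RamExpr → RamExpr) (j : RamExpr) : RamExpr :=
  ite j a (f j) (g (sub j a))

/-- Case distinction on an equality. -/
def ifEq (a b p q : RamExpr) : RamExpr := ite a b q (ite b a q p)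

@[simp] theorem eval_ifEq (env : Fin 4 → ℕ) (mem : ℕ → ℕ) (a b p q : RamExpr) :
    (ifEq a b p q).eval env mem =
      if a.eval env mem = b.eval env mem then p.eval env mem else q.eval env mem := by
  simp only [ifEq, eval_ite]
  split_ifs <;> first | rfl | omega

/-- The number of vertices of a layered instance. -/
def size6 : RamExpr := mul (lit 6) (var 1)

/-- The entry of the given adjacency matrix for the vertices of two layers. -/
def entry (v w : RamExpr) : RamExpr :=
  load (add (var 0) (add (mul (div v (lit 6)) (var 1)) (div w (lit 6))))

/-- The entries of an encoding with `k` sets. -/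
def layered (edge : RamExpr → RamExpr → RamExpr) (random : RamExpr → RamExpr)
    (rest : RamExpr → RamExpr) : RamExpr → RamExpr :=
  append (lit 1) (fun _ => size6) <|
  append (mul size6 size6) (fun j => edge (div j size6) (mod j size6)) <|
  append size6 random rest

/-- The entries of the encoding of `n` sets. -/
def sets (target : RamExpr → RamExpr → RamExpr) : RamExpr → RamExpr :=
  append (lit 1) (fun _ => var 1) fun j => target (div j size6) (mod j size6)

end RamExpr

/-- The function described by `RamExpr.layered`. -/
def layeredFun (n : ℕ) (edge : ℕ → ℕ → ℕ) (random rest : ℕ → ℕ) : ℕ → ℕ :=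
  appendFun 1 (fun _ => 6 * n) <|
  appendFun (6 * n * (6 * n)) (fun j => edge (j / (6 * n)) (j % (6 * n))) <|
  appendFun (6 * n) random rest

/-- The function described by `RamExpr.sets`. -/
def setsFun (n : ℕ) (target : ℕ → ℕ → ℕ) : ℕ → ℕ :=
  appendFun 1 (fun _ => n) fun j => target (j / (6 * n)) (j % (6 * n))

theorem encode_eq_map_layeredFun {n : ℕ} (P : MDP (6 * n)) {edge : ℕ → ℕ → ℕ}
    {random rest : ℕ → ℕ} {len : ℕ} {l : List ℕ}
    (he : ∀ v w : Fin (6 * n), bit ((v, w) ∈ P.edges) = edge v w)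
    (hr : ∀ v : Fin (6 * n), bit (v ∈ P.random) = random v)
    (hl : l = (List.range len).map rest) :
    P.encode ++ l = (List.range (1 + (6 * n * (6 * n) + (6 * n + len)))).map
      (layeredFun n edge random rest) := by
  rw [layeredFun, map_range_one_add, map_range_append, map_range_append, MDP.encode,
    encodeEdges_eq _ edge he, encodeSet_eq _ random hr, hl]
  simp

theorem encodeSets_eq_map_setsFun {n : ℕ} (T : Fin n → Finset (Fin (6 * n))) {target : ℕ → ℕ → ℕ}
    (ht : ∀ (k : Fin n) (v : Fin (6 * n)), bit (v ∈ T k) = target k v) :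
    encodeSets T = (List.range (1 + n * (6 * n))).map (setsFun n target) := by
  rw [setsFun, map_range_one_add, encodeSets_eq T target ht]

theorem bit_eq_ite {p : Prop} [Decidable p] : bit p = if p then 1 else 0 := by
  unfold bit
  split_ifs <;> rfl

/-- The matrix of `CycleEdge`, where `m` lists the entries of the given adjacency matrix. -/
def cycleEdgeFun (n : ℕ) (m : ℕ → ℕ) (v w : ℕ) : ℕ :=
  if w % 6 = 5 then 1 else
  if v % 6 = 0 then if w % 6 = 1 then 1 else 0 else
  if v % 6 = 4 then if w % 6 = 0 then 1 else 0 else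
  if v % 6 = 5 then 0 else
  if w % 6 = v % 6 + 1 then m (v / 6 * n + w / 6) else 0

/-- The characteristic function of `cycleTarget`. -/
def cycleTargetFun (k v : ℕ) : ℕ :=
  if v % 6 = 5 then 1 else
  if v / 6 = k then 0 else
  if v % 6 = 1 then 1 else if v % 6 = 4 then 1 else 0

/-- The matrix of `AbsorbingEdge`, where `m` lists the entries of the given adjacency matrix. -/
def absorbingEdgeFun (n : ℕ) (m : ℕ → ℕ) (v w : ℕ) : ℕ :=
  if v % 6 = 0 then if w % 6 = 1 then 1 else 0 else
  if v % 6 = 1 then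
    if v / 6 = w / 6 then if w % 6 = 2 then 1 else if w % 6 = 5 then 1 else 0 else 0 else
  if v = w then 1 else
  if v % 6 = 5 then 0 else
  if w % 6 = v % 6 + 1 then m (v / 6 * n + w / 6) else 0

namespace RamExpr

/-- The expression for `cycleEdgeFun`. -/
def cycleEdge (v w : RamExpr) : RamExpr :=
  ifEq (mod w (lit 6)) (lit 5) (lit 1) <|
  ifEq (mod v (lit 6)) (lit 0) (ifEq (mod w (lit 6)) (lit 1) (lit 1) (lit 0)) <|
  ifEq (mod v (lit 6)) (lit 4) (ifEq (mod w (lit 6)) (lit 0) (lit 1) (lit 0)) <|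
  ifEq (mod v (lit 6)) (lit 5) (lit 0) <|
  ifEq (mod w (lit 6)) (add (mod v (lit 6)) (lit 1)) (entry v w) (lit 0)

/-- The expression for `cycleTargetFun`. -/
def cycleTarget (k v : RamExpr) : RamExpr :=
  ifEq (mod v (lit 6)) (lit 5) (lit 1) <|
  ifEq (div v (lit 6)) k (lit 0) <|
  ifEq (mod v (lit 6)) (lit 1) (lit 1) (ifEq (mod v (lit 6)) (lit 4) (lit 1) (lit 0))

/-- The expression for `absorbingEdgeFun`. -/
def absorbingEdge (v w : RamExpr) : RamExpr :=
  ifEq (mod v (lit 6)) (lit 0) (ifEq (mod w (lit 6)) (lit 1) (lit 1) (lit 0)) <|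
  ifEq (mod v (lit 6)) (lit 1) (ifEq (div v (lit 6)) (div w (lit 6))
    (ifEq (mod w (lit 6)) (lit 2) (lit 1) (ifEq (mod w (lit 6)) (lit 5) (lit 1) (lit 0)))
    (lit 0)) <|
  ifEq v w (lit 1) <|
  ifEq (mod v (lit 6)) (lit 5) (lit 0) <|
  ifEq (mod w (lit 6)) (add (mod v (lit 6)) (lit 1)) (entry v w) (lit 0)

end RamExpr

namespace TriangleInst

variable (I : TriangleInst)

/-- Since `w / 6 < I.n`, the row-major index determines the pair and lies within the matrix. -/
theorem matrix_entry {v w : ℕ} (hv : v < 6 * I.n) (hw : w < 6 * I.n) :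
    bit (v / 6 * I.n + w / 6 < I.n * I.n ∧
      I.Adj ((v / 6 * I.n + w / 6) / I.n) ((v / 6 * I.n + w / 6) % I.n)) =
      bit (I.Adj (v / 6) (w / 6)) := by
  have hw' : w / 6 < I.n := by omega
  have h1 : (v / 6 * I.n + w / 6) / I.n = v / 6 := by
    rw [Nat.mul_comm, Nat.mul_add_div (by omega), Nat.div_eq_of_lt hw', Nat.add_zero]
  have h2 : (v / 6 * I.n + w / 6) % I.n = w / 6 := by
    rw [Nat.mul_comm, Nat.mul_add_mod, Nat.mod_eq_of_lt hw']
  have h3 : v / 6 * I.n + w / 6 < I.n * I.n := by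
    have : (v / 6 + 1) * I.n ≤ I.n * I.n := Nat.mul_le_mul_right _ (by omega)
    rw [Nat.add_mul] at this
    omega
  rw [h1, h2]
  exact bit_congr ⟨fun h => h.2, fun h => ⟨h3, h⟩⟩

/-- The entries of the adjacency matrix, row by row. -/
noncomputable def matrix (j : ℕ) : ℕ := bit (j < I.n * I.n ∧ I.Adj (j / I.n) (j % I.n))

theorem bit_mem_cycleGraph_edges (v w : Fin (6 * I.n)) :
    bit ((v, w) ∈ I.cycleGraph.edges) = cycleEdgeFun I.n I.matrix v w := by
  classical
  rw [bit_congr (I.mem_cycleGraph_edges v w), cycleEdgeFun, matrix, I.matrix_entry v.2 w.2,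
    CycleEdge]
  have : (v : ℕ) % 6 < 6 := Nat.mod_lt _ (by omega)
  by_cases hA : I.Adj ((v : ℕ) / 6) ((w : ℕ) / 6) <;>
    simp only [hA, bit_eq_ite, and_true, and_false, or_false, if_true, if_false] <;>
    split_ifs <;> first | rfl | omega

theorem bit_mem_cycleTargets (k : Fin I.n) (v : Fin (6 * I.n)) :
    bit (v ∈ I.cycleTargets k) = cycleTargetFun k v := by
  classical
  rw [bit_congr (I.mem_cycleTargets k v), cycleTargetFun, cycleTarget]
  simp only [bit_eq_ite]
  split_ifs <;> first | rfl | omega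

theorem bit_mem_absorbingMDP_edges (v w : Fin (6 * I.n)) :
    bit ((v, w) ∈ I.absorbingMDP.edges) = absorbingEdgeFun I.n I.matrix v w := by
  classical
  rw [bit_congr (I.mem_absorbingMDP_edges v w), absorbingEdgeFun, matrix,
    I.matrix_entry v.2 w.2, AbsorbingEdge]
  have : (v : ℕ) % 6 < 6 := Nat.mod_lt _ (by omega)
  by_cases hA : I.Adj ((v : ℕ) / 6) ((w : ℕ) / 6) <;>
    simp only [hA, bit_eq_ite, and_true, and_false, or_false, if_true, if_false] <;>
    split_ifs <;> first | rfl | omega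

theorem answer_eq_cons {S : Set (Fin (6 * I.n))} (h : I.start ∈ S ↔ I.HasTriangle) :
    ∃ l, encodeSet S = bit I.HasTriangle :: l := by
  rw [← bit_congr h]
  exact encodeSet_eq_cons _ S

end TriangleInst

/-! ### The five reductions -/

/-- The data of a reduction whose instances have one family of target sets. -/
def TriangleReduction.ofTargets {Q : Problem} (edge : RamExpr → RamExpr → RamExpr)
    (edgeFun : ℕ → (ℕ → ℕ) → ℕ → ℕ → ℕ) (random : RamExpr → RamExpr) (randomFun : ℕ → ℕ)
    (target : RamExpr → RamExpr → RamExpr) (targetFun : ℕ → ℕ → ℕ)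
    (h : ∀ n i a mem, (layered edge random (sets target) (var 2)).eval ![a, n, i, a] mem =
      layeredFun n (edgeFun n fun c => mem (a + c)) randomFun (setsFun n targetFun) i)
    (P : ∀ I : TriangleInst, MDP (6 * I.n)) (T : ∀ I : TriangleInst, Fin I.n → Finset (Fin (6 * I.n)))
    (hedge : ∀ I v w, bit ((v, w) ∈ (P I).edges) = edgeFun I.n I.matrix v w)
    (hrandom : ∀ I v, bit (v ∈ (P I).random) = randomFun v)
    (htarget : ∀ I k v, bit (v ∈ T I k) = targetFun k v)
    (inst : TriangleInst → Q.Inst) (n_inst : ∀ I, Q.n (inst I) = 6 * I.n)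
    (k_inst : ∀ I, Q.k (inst I) = I.n)
    (answer_inst : ∀ I, ∃ l, Q.answer (inst I) = bit I.HasTriangle :: l)
    (encode_inst : ∀ I, Q.encode (inst I) = (P I).encode ++ encodeSets (T I)) :
    TriangleReduction Q where
  lenE := add (lit 1) (add (mul size6 size6) (add size6 (add (lit 1) (mul (var 1) size6))))
  f := layered edge random (sets target) (var 2)
  A n := 1 + (6 * n * (6 * n) + (6 * n + (1 + n * (6 * n))))
  F n m := layeredFun n (edgeFun n m) randomFun (setsFun n targetFun)
  -- The length is `42 * n ^ 2 + 6 * n + 2`, and `n ≤ n ^ 2`.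
  K := 50
  eval_lenE _ _ := rfl
  eval_f := h
  lt_A n := by nlinarith
  A_le n := by nlinarith [Nat.le_mul_self n]
  inst := inst
  n_inst := n_inst
  k_inst := k_inst
  answer_inst := answer_inst
  encode_inst I := by
    rw [encode_inst, encode_eq_map_layeredFun (P I) (hedge I) (hrandom I)
      (encodeSets_eq_map_setsFun (T I) (htarget I))]
    rfl

/-- The reduction to the disjunctive Büchi query. -/
noncomputable def buchiQueryReduction : TriangleReduction mdpDisjBuchiQuery :=
  .ofTargets absorbingEdge absorbingEdgeFun
    (fun v => ifEq (mod v (lit 6)) (lit 1) (lit 1) (lit 0)) (fun v => if v % 6 = 1 then 1 else 0)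
    (fun k v => ifEq v (add (mul (lit 6) k) (lit 5)) (lit 1) (lit 0))
    (fun k v => if v = 6 * k + 5 then 1 else 0)
    (fun n i a mem => by
      simp [layered, sets, append, size6, entry, layeredFun, setsFun, appendFun, absorbingEdge,
        absorbingEdgeFun]
      rfl)
    (fun I => I.absorbingMDP) (fun I => I.absorbingTargets)
    (fun I => I.bit_mem_absorbingMDP_edges)
    (fun I v => by rw [bit_congr (I.mem_absorbingMDP_random v), bit_eq_ite])
    (fun I k v => by rw [bit_congr (I.mem_absorbingTargets k v), bit_eq_ite])
    (fun I => ⟨6 * I.n, I.n, by have := I.pos; omega, I.absorbingMDP, I.absorbingTargets⟩)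
    (fun _ => rfl) (fun _ => rfl) (fun I => I.answer_eq_cons I.start_mem_disjQuery_buchi_iff)
    (fun _ => rfl)

theorem eval_layered_cycle (n i a : ℕ) (mem : ℕ → ℕ) :
    (layered cycleEdge (fun _ => lit 0) (sets RamExpr.cycleTarget) (var 2)).eval
      ![a, n, i, a] mem = layeredFun n (cycleEdgeFun n fun c => mem (a + c)) (fun _ => 0)
        (setsFun n cycleTargetFun) i := by
  simp [layered, sets, append, size6, entry, layeredFun, setsFun, appendFun, cycleEdge,
    cycleEdgeFun, RamExpr.cycleTarget, cycleTargetFun]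

theorem TriangleInst.bit_mem_cycleGraph_random (I : TriangleInst) (v : Fin (6 * I.n)) :
    bit (v ∈ I.cycleGraph.random) = 0 := by
  simp [bit, cycleGraph]

/-- The layered graph with its target sets. -/
noncomputable def TriangleInst.cycleInst (I : TriangleInst) : TargetInst :=
  ⟨6 * I.n, I.n, by have := I.pos; omega, I.cycleGraph, I.cycleTargets⟩

/-- A reduction to a problem on the layered graph with its target sets. -/
noncomputable def cycleReduction {Q : Problem} (inst : TriangleInst → Q.Inst)
    (n_inst : ∀ I, Q.n (inst I) = 6 * I.n) (k_inst : ∀ I, Q.k (inst I) = I.n)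
    (answer_inst : ∀ I, ∃ l, Q.answer (inst I) = bit I.HasTriangle :: l)
    (encode_inst : ∀ I, Q.encode (inst I) = I.cycleGraph.encode ++ encodeSets I.cycleTargets) :
    TriangleReduction Q :=
  .ofTargets cycleEdge cycleEdgeFun (fun _ => lit 0) (fun _ => 0) RamExpr.cycleTarget
    cycleTargetFun eval_layered_cycle (fun I => I.cycleGraph) (fun I => I.cycleTargets)
    (fun I => I.bit_mem_cycleGraph_edges) (fun I => I.bit_mem_cycleGraph_random)
    (fun I => I.bit_mem_cycleTargets) inst n_inst k_inst answer_inst encode_inst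

/-- The reduction to the disjunctive coBüchi objective on graphs. -/
noncomputable def graphCoBuchiReduction : TriangleReduction graphDisjCoBuchiObjective :=
  cycleReduction (fun I => ⟨I.cycleInst, rfl⟩) (fun _ => rfl) (fun _ => rfl)
    (fun I => I.answer_eq_cons I.start_mem_disjObjective_coBuchi_iff) (fun _ => rfl)

/-- The reduction to the disjunctive coBüchi objective. -/
noncomputable def coBuchiObjectiveReduction : TriangleReduction mdpDisjCoBuchiObjective :=
  cycleReduction (fun I => I.cycleInst) (fun _ => rfl) (fun _ => rfl)
    (fun I => I.answer_eq_cons I.start_mem_disjObjective_coBuchi_iff) (fun _ => rfl)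

/-- The reduction to the disjunctive coBüchi query. -/
noncomputable def coBuchiQueryReduction : TriangleReduction mdpDisjCoBuchiQuery :=
  cycleReduction (fun I => I.cycleInst) (fun _ => rfl) (fun _ => rfl)
    (fun I => I.answer_eq_cons I.start_mem_disjQuery_coBuchi_iff) (fun _ => rfl)

/-- The reduction to the Rabin objective. -/
noncomputable def rabinReduction : TriangleReduction mdpRabinObjective where
  lenE := add (lit 1) (add (mul size6 size6) (add size6
    (add (add (lit 1) (mul (var 1) size6)) (add (lit 1) (mul (var 1) size6)))))
  f := layered cycleEdge (fun _ => lit 0) (append (add (lit 1) (mul (var 1) size6))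
    (sets fun _ _ => lit 1) (sets RamExpr.cycleTarget)) (var 2)
  A n := 1 + (6 * n * (6 * n) + (6 * n + ((1 + n * (6 * n)) + (1 + n * (6 * n)))))
  F n m := layeredFun n (cycleEdgeFun n m) (fun _ => 0) (appendFun (1 + n * (6 * n))
    (setsFun n fun _ _ => 1) (setsFun n cycleTargetFun))
  K := 60
  eval_lenE _ _ := rfl
  eval_f n i a mem := by
    simp [layered, sets, append, size6, entry, layeredFun, setsFun, appendFun, cycleEdge,
      cycleEdgeFun, RamExpr.cycleTarget, cycleTargetFun]
  lt_A n := by nlinarith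
  A_le n := by nlinarith [Nat.le_mul_self n]
  inst I := ⟨6 * I.n, I.n, by have := I.pos; omega, I.cycleGraph, fun _ => Finset.univ,
    I.cycleTargets⟩
  n_inst _ := rfl
  k_inst _ := rfl
  answer_inst I := I.answer_eq_cons I.start_mem_asWin_rabin_iff
  encode_inst I := by
    refine encode_eq_map_layeredFun I.cycleGraph I.bit_mem_cycleGraph_edges
      I.bit_mem_cycleGraph_random ?_
    rw [map_range_append]
    exact congrArg₂ _ (encodeSets_eq_map_setsFun _ fun _ _ => by simp [bit])
      (encodeSets_eq_map_setsFun _ I.bit_mem_cycleTargets)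

theorem mainTheorem7 (Combinatorial : Set Prog)
    (hclosed : ClosedUnderLinearTimePreprocessing Combinatorial)
    (hSTC : StrongTriangleConjecture Combinatorial) :
    NoFastAlgorithm Combinatorial mdpDisjBuchiQuery ∧
    (NoFastAlgorithm Combinatorial graphDisjCoBuchiObjective ∧
      NoFastAlgorithm Combinatorial mdpDisjCoBuchiObjective ∧
      NoFastAlgorithm Combinatorial mdpDisjCoBuchiQuery) ∧
    NoFastAlgorithm Combinatorial mdpRabinObjective :=
  ⟨buchiQueryReduction.noFastAlgorithm hclosed hSTC,
    ⟨graphCoBuchiReduction.noFastAlgorithm hclosed hSTC,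
      coBuchiObjectiveReduction.noFastAlgorithm hclosed hSTC,
      coBuchiQueryReduction.noFastAlgorithm hclosed hSTC⟩,
    rabinReduction.noFastAlgorithm hclosed hSTC⟩
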